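/- Let $|\psi\rangle_{A_1\cdots A_n}$ be an $n$-qudit GWV state, i.e. a superposition of a generalized $W$-class state and the vacuum, $$|\psi\rangle=\sqrt p\,\sum_{s=1}^{n}\sum_{i=1}^{d-1}a_{si}|0\cdots 0\,i\,0\cdots 0\rangle+\sqrt{1-p}\,|0\cdots 0\rangle ,\qquad 0\le p\le 1,\quad \sum_{s=1}^{n}\sum_{i=1}^{d-1}|a_{si}|^2=1,$$ where $i$ stands at position $s$. Let $P,P_0,\dots,P_{r-1}$ be pairwise disjoint nonempty subsets of $\{A_1,\dots,A_n\}$ (a partition of their union, which need not be the whole set), and let $\rho_{P|P_0\cdots P_{r-1}}$ and $\rho_{PP_j}$ be the reduced density matrices of $|\psi\rangle\langle\psi|$ on $P\cup P_0\cup\dots\cup P_{r-1}$ and on $P\cup P_j$, regarded as bipartite states of $P$ with $P_0\cup\dots\cup P_{r-1}$ and of $P$ with $P_j$, respectively. For a bipartite state $\rho_{AB}$ the Rényi-$\alpha$ entanglement of assistance is $$E_\alpha^a(\rho_{AB})=\max_{\{p_i,|\psi_i\rangle\}}\sum_i p_i\,S_\alpha\big(\mathrm{tr}_B|\psi_i\rangle\langle\psi_i|\big),$$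 the maximum being over all pure state decompositions $\rho_{AB}=\sum_i p_i|\psi_i\rangle\langle\psi_i|$, where $S_\alpha(\rho)=\frac1{1-\alpha}\log_2\mathrm{tr}\,\rho^\alpha$ for $\alpha\ne1$ and $S_1(\rho)=-\mathrm{tr}\,\rho\log_2\rho$. Let $\alpha\in\big[\frac{\sqrt7-1}2,\frac{\sqrt{13}-1}2\big]$, $\mu\in(0,1]$ and $0<k\le1$, and suppose that $k\,E_\alpha^a(\rho_{PP_j})\ge E_\alpha^a(\rho_{PP_{j+1}})$ for $j=0,1,\dots,r-2$. Then $$\big[E_\alpha^a(\rho_{P|P_0\cdots P_{r-1}})\big]^\mu\le\sum_{j=0}^{r-1}\mathcal K_\mu^{\,\omega_H(j)}\,\big[E_\alpha^a(\rho_{PP_j})\big]^\mu,\qquad \mathcal K_\mu=\frac{(1+k)^\mu-1}{k^\mu},$$ where $\omega_H(j)$ is the Hamming weight of $j$, the number of ones in its binary expansion. -/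

import Mathlib

namespace GWV

noncomputable section

/-! ### Entanglement of assistance of a bipartite state -/

section Bipartite

variable {A B : Type*} [Fintype A] [DecidableEq A] [Fintype B]

/-- The rank-one operator `|ψ⟩⟨ψ|`. -/
def proj {X : Type*} (ψ : X → ℂ) : Matrix X X ℂ :=
  Matrix.vecMulVec ψ (star ψ)

/-- `ψ` is a unit vector of `ℂ^X`. -/
def IsUnitVec {X : Type*} [Fintype X] (ψ : X → ℂ) : Prop :=
  ∑ x, ‖ψ x‖ ^ 2 = 1

/-- Partial trace over the second factor: `ρ_A = tr_B ρ_{AB}`. -/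
def traceRight {A B : Type*} [Fintype B] (ρ : Matrix (A × B) (A × B) ℂ) : Matrix A A ℂ :=
  Matrix.of fun a a' => ∑ b, ρ (a, b) (a', b)

theorem proj_isHermitian {X : Type*} (ψ : X → ℂ) : (proj ψ).IsHermitian := by
  ext x y
  simp [proj, Matrix.vecMulVec_apply, mul_comm]

theorem traceRight_isHermitian {A B : Type*} [Fintype B] {ρ : Matrix (A × B) (A × B) ℂ}
    (hρ : ρ.IsHermitian) : (traceRight ρ).IsHermitian := by
  ext a a'
  simp [traceRight, hρ.apply]

/-- The Rényi-`α` entropy of a Hermitian matrix, computed from its eigenvalues; at `α = 1` it is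
the von Neumann entropy, the limit of the Rényi entropies as `α → 1`.  Logarithms have base 2. -/
def renyiEntropy (α : ℝ) (ρ : Matrix A A ℂ) (hρ : ρ.IsHermitian) : ℝ :=
  if α = 1 then -∑ i, hρ.eigenvalues i * Real.logb 2 (hρ.eigenvalues i)
  else 1 / (1 - α) * Real.logb 2 (∑ i, hρ.eigenvalues i ^ α)

/-- The Rényi-`α` entanglement `S_α(tr_B |ψ⟩⟨ψ|)` of a bipartite pure state. -/
def renyiEntanglement (α : ℝ) (ψ : A × B → ℂ) : ℝ :=
  renyiEntropy α (traceRight (proj ψ)) (traceRight_isHermitian (proj_isHermitian ψ))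

/-- `{p_i, |ψ_i⟩}` is a pure state decomposition of `ρ`. -/
structure IsPureDecomposition {X : Type*} [Fintype X] (ρ : Matrix X X ℂ) {N : ℕ}
    (p : Fin N → ℝ) (ψ : Fin N → X → ℂ) : Prop where
  nonneg : ∀ i, 0 ≤ p i
  sum_eq_one : ∑ i, p i = 1
  unit : ∀ i, IsUnitVec (ψ i)
  decomp : ρ = ∑ i, (p i : ℂ) • proj (ψ i)

/-- The Rényi-`α` entanglement of assistance of a bipartite state: the largest average
entanglement over all pure state decompositions. -/
def renyiAssistance (α : ℝ) (ρ : Matrix (A × B) (A × B) ℂ) : ℝ :=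
  sSup {e : ℝ | ∃ (N : ℕ) (p : Fin N → ℝ) (ψ : Fin N → A × B → ℂ),
    IsPureDecomposition ρ p ψ ∧ e = ∑ i, p i * renyiEntanglement α (ψ i)}

end Bipartite

/-! ### Systems of `n` qudits; a configuration is a map from the qudits to the levels `Fin d` -/

section Qudits

variable {n d : ℕ}

/-- Glue levels on `S` and levels on its complement. -/
def extend {S : Finset (Fin n)} (x : S → Fin d) (z : ↥(Sᶜ) → Fin d) : Fin n → Fin d :=
  fun i => if h : i ∈ S then x ⟨i, h⟩ else z ⟨i, Finset.mem_compl.2 h⟩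

/-- The reduced density matrix `ρ_S` of an `n`-qudit state: the qudits outside `S` are
traced out. -/
def reduced (ρ : Matrix (Fin n → Fin d) (Fin n → Fin d) ℂ) (S : Finset (Fin n)) :
    Matrix (S → Fin d) (S → Fin d) ℂ :=
  Matrix.of fun x x' => ∑ z : ↥(Sᶜ) → Fin d, ρ (extend x z) (extend x' z)

/-- Glue levels on `P` and levels on `Q`; for disjoint `P` and `Q` this is a bijection. -/
def merge {P Q : Finset (Fin n)} (w : (P → Fin d) × (Q → Fin d)) : ↥(P ∪ Q) → Fin d :=
  fun i => if h : i.1 ∈ P then w.1 ⟨i.1, h⟩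
    else w.2 ⟨i.1, (Finset.mem_union.1 i.2).resolve_left h⟩

/-- The reduced density matrix `ρ_{P|Q}` on the qudits of the disjoint sets `P` and `Q`, as a
bipartite state of `P` and `Q`. -/
def reducedCut (ρ : Matrix (Fin n → Fin d) (Fin n → Fin d) ℂ) (P Q : Finset (Fin n)) :
    Matrix ((P → Fin d) × (Q → Fin d)) ((P → Fin d) × (Q → Fin d)) ℂ :=
  (reduced ρ (P ∪ Q)).submatrix merge merge

/-- The computational basis vector `|y⟩`. -/
def ket (y : Fin n → Fin d) : (Fin n → Fin d) → ℂ :=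
  fun x => if x = y then 1 else 0

variable [NeZero d]

/-- The generalized `W`-class vector `∑_s ∑_{i ≠ 0} a_{si} |0 … 0 i 0 … 0⟩`, with `i` at
place `s`. -/
def genW (a : Fin n → Fin d → ℂ) : (Fin n → Fin d) → ℂ :=
  ∑ s, ∑ i ∈ Finset.univ.erase 0, a s i • ket (Pi.single s i)

/-- The superposition `√p |W⟩ + √(1 - p) |0 … 0⟩`. -/
def gwvVec (p : ℝ) (a : Fin n → Fin d → ℂ) : (Fin n → Fin d) → ℂ :=
  (√p : ℂ) • genW a + (√(1 - p) : ℂ) • ket 0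

/-- `ψ` is an `n`-qudit GWV state: a superposition of a normalized generalized `W`-class state
and the vacuum. -/
def IsGWV (ψ : (Fin n → Fin d) → ℂ) : Prop :=
  ∃ (p : ℝ) (a : Fin n → Fin d → ℂ), 0 ≤ p ∧ p ≤ 1 ∧
    ∑ s, ∑ i ∈ Finset.univ.erase 0, ‖a s i‖ ^ 2 = 1 ∧ ψ = gwvVec p a

end Qudits

/-- The Hamming weight of the binary expansion of `j`. -/
def hammingWeight (j : ℕ) : ℕ :=
  (Nat.digits 2 j).count 1

end

end GWV

namespace GWV

/-! ### Monotonicity of the binary Rényi entropy relative to the linear entropy -/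

/-! The argument is polygamy of the assistance (the case `μ = 1` with unit weights), followed by an
elementary inequality for powers of ordered numbers.

A GWV state has no amplitude on configurations with two excited qudits. A vanishing diagonal entry
of a reduced state forces the same amplitude to vanish in every member of positive weight of every
pure decomposition, so all such members again have at most one excitation. For a pure state of this
kind on a cut, the reduced state on one side is a pure vector plus a multiple of the vacuum. Its
rank is at most two and its spectrum is `l`, `1 - l`, where `l (1 - l) = D` is the product of the
excitation weights of the two sides (`weightProd`). The entanglement is thus a function `h(D)`,
namely `productRenyi`.

Two facts give polygamy. First, `D` is additive when the second side is split into parts, since its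
single excitation lies in exactly one part, and `h` is subadditive because `h(D) / D` decreases
(`productRenyi_ratio`). Second, discarding the other parts mixes in some vacuum, and the mixture is
an equal-weight ensemble of two pure states that differ only in the vacuum amplitude and so keep the
same `D` (`exists_vacuum_ensemble`). Every decomposition of the large state therefore yields
decompositions of all marginals whose averages of `h` sum to at least its own.

The analytic core is that `h(D) / D` decreases for `0 < α` and `α ^ 2 + α ≤ 3`. By a monotone
l'Hôpital rule it is enough that `h'` decreases in `D`; in half the log-odds `y`, and with `b = α -
1`, this becomes the sign of a combination of hyperbolic sines, read off from its Taylor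
coefficients.

Finally, `add_rpow_le` splits the `μ`-th power of a sum of two ordered terms, and repeated pairing
of neighbours turns the number of splittings into a Hamming weight. -/

theorem hyperbolic_coeff_nonneg {b : ℝ} (hb : 0 ≤ b) (hb' : b ^ 2 + 3 * b ≤ 1) (n : ℕ) :
    0 ≤ b * 3 ^ (2 * n + 1) + (b + 4) - 3 * (1 + 2 * b) ^ (2 * n + 1)
      - (1 - 2 * b) ^ (2 * n + 1) := by
  have hb1 : b ≤ 1 / 3 := by nlinarith
  rcases n with _ | n
  · ring_nf; rfl
  induction n with
  | zero =>
    -- This is the cubic coefficient, the first that does not vanish identically. With `b = α - 1`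
    -- the condition `hb'` is `α ^ 2 + α ≤ 3`.
    have : 0 ≤ 16 * b * (1 - 3 * b - b ^ 2) := by
      apply mul_nonneg (by linarith); linarith
    norm_num
    nlinarith
  | succ n ih =>
    have h1 := one_add_mul_le_pow (a := 2 * b) (by linarith) (2 * (n + 1) + 1)
    have h2 := one_add_mul_le_pow (a := -(2 * b)) (by linarith) (2 * (n + 1) + 1)
    rw [← sub_eq_add_neg] at h2
    have e : ∀ x : ℝ, x ^ (2 * (n + 1 + 1) + 1) = x ^ 2 * x ^ (2 * (n + 1) + 1) := by
      intro x; ring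
    rw [e, e, e]
    have hk : (3 : ℝ) ≤ ((2 * (n + 1) + 1 : ℕ) : ℝ) := by push_cast; linarith [n.cast_nonneg (α := ℝ)]
    generalize ((2 * (n + 1) + 1 : ℕ) : ℝ) = k at *
    generalize (1 + 2 * b) ^ (2 * (n + 1) + 1) = u at *
    generalize (1 - 2 * b) ^ (2 * (n + 1) + 1) = v at *
    generalize (3 : ℝ) ^ (2 * (n + 1) + 1) = w at *
    -- The coefficient at exponent `k + 2` minus nine times the one at `k` is `3 (8 - 4b - 4b²) u +
    -- (8 + 4b - 4b²) v - 8 (b + 4)`. Bernoulli's bounds on `u` and `v` make it nonnegative once `k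
    -- ≥ 3`.
    have h3 : 0 ≤ (8 - 4 * b - 4 * b ^ 2) * (u - (1 + k * (2 * b))) :=
      mul_nonneg (by nlinarith) (by linarith)
    have h4 : 0 ≤ (8 + 4 * b - 4 * b ^ 2) * (v - (1 + k * -(2 * b))) :=
      mul_nonneg (by nlinarith) (by linarith)
    have h5 : 0 ≤ b * (k - 3) * (16 - 16 * b - 8 * b ^ 2) :=
      mul_nonneg (mul_nonneg hb (by linarith)) (by nlinarith)
    have h6 : 0 ≤ b * (80 - 112 * b - 48 * b ^ 2) := mul_nonneg hb (by nlinarith)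
    nlinarith

theorem hyperbolic_coeff_nonpos {b : ℝ} (hb : b ≤ 0) (hb' : -1 ≤ b) (n : ℕ) :
    b * 3 ^ (2 * n + 1) + (b + 4) - 3 * (1 + 2 * b) ^ (2 * n + 1)
      - (1 - 2 * b) ^ (2 * n + 1) ≤ 0 := by
  have h1 := one_add_mul_le_pow (a := 2 * b) (by linarith) (2 * n + 1)
  have h2 := one_add_mul_le_pow (a := -(2 * b)) (by linarith) (2 * n + 1)
  have h3 := one_add_mul_le_pow (a := (2 : ℝ)) (by norm_num) (2 * n + 1)
  rw [← sub_eq_add_neg] at h2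
  have e : (1 : ℝ) + 2 = 3 := by norm_num
  rw [e] at h3
  push_cast at *
  -- Bernoulli's `4n + 3` in `h3` is too weak; with `8n + 3` the linear bounds cancel exactly.
  have h4 : (8 * n + 3 : ℝ) ≤ 3 ^ (2 * n + 1) := by
    rcases n with _ | n
    · norm_num
    · have h5 := one_add_mul_le_pow (a := (8 : ℝ)) (by norm_num) (n + 1)
      have : (3 : ℝ) ^ (2 * (n + 1) + 1) = 3 * (1 + 8) ^ (n + 1) := by
        rw [pow_succ, pow_mul]; norm_num; ring
      rw [this]; push_cast at *
      linarith [n.cast_nonneg (α := ℝ)]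
  nlinarith

theorem hasSum_hyperbolic (b y : ℝ) :
    HasSum (fun n : ℕ => (b * 3 ^ (2 * n + 1) + (b + 4) - 3 * (1 + 2 * b) ^ (2 * n + 1)
      - (1 - 2 * b) ^ (2 * n + 1)) * (y ^ (2 * n + 1) / (2 * n + 1).factorial))
      (b * Real.sinh (3 * y) + (b + 4) * Real.sinh y - 3 * Real.sinh ((1 + 2 * b) * y)
        - Real.sinh ((1 - 2 * b) * y)) := by
  refine (congrArg (fun f => HasSum f _) (funext fun n => ?_)).mpr (((((Real.hasSum_sinh (3 * y)).mul_left b).add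
    ((Real.hasSum_sinh y).mul_left (b + 4))).sub
    ((Real.hasSum_sinh ((1 + 2 * b) * y)).mul_left 3)).sub
    (Real.hasSum_sinh ((1 - 2 * b) * y)))
  simp only [mul_pow]
  ring

/-- All Taylor coefficients in `y` have the sign of `b`; dividing by `b` treats `α < 1` and `α > 1`
together. -/
theorem hyperbolic_div_nonneg {b y : ℝ} (hy : 0 ≤ y) (hb : -1 ≤ b) (hb' : b ^ 2 + 3 * b ≤ 1) :
    0 ≤ (b * Real.sinh (3 * y) + (b + 4) * Real.sinh y - 3 * Real.sinh ((1 + 2 * b) * y)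
        - Real.sinh ((1 - 2 * b) * y)) / b := by
  rcases le_total 0 b with h | h
  · refine div_nonneg ((hasSum_hyperbolic b y).nonneg fun n => ?_) h
    exact mul_nonneg (hyperbolic_coeff_nonneg h hb' n) (by positivity)
  · refine div_nonneg_of_nonpos ((hasSum_hyperbolic b y).nonpos fun n => ?_) h
    exact mul_nonpos_of_nonpos_of_nonneg (hyperbolic_coeff_nonpos h hb n) (by positivity)

/-- The left side is, up to a positive factor, the numerator of the derivative in
`monotoneOn_hyperbolic_ratio`. Turning products into sums makes its Taylor coefficients explicit. -/
theorem hyperbolic_identity (b y : ℝ) :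
    4 * ((b * Real.cosh (b * y) * Real.cosh y + 2 * Real.sinh (b * y) * Real.sinh y) * Real.sinh y
          * Real.cosh ((1 + b) * y)
        - Real.sinh (b * y) * Real.cosh y * (Real.cosh y * Real.cosh ((1 + b) * y)
          + (1 + b) * Real.sinh y * Real.sinh ((1 + b) * y)))
      = b * Real.sinh (3 * y) + (b + 4) * Real.sinh y - 3 * Real.sinh ((1 + 2 * b) * y)
        - Real.sinh ((1 - 2 * b) * y) := by
  have e1 : (1 + b) * y = y + b * y := by ring
  have e2 : (1 + 2 * b) * y = y + (b * y + b * y) := by ring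
  have e3 : (1 - 2 * b) * y = y + (-(b * y) + -(b * y)) := by ring
  have e4 : 3 * y = y + (y + y) := by ring
  rw [e1, e2, e3, e4]
  simp only [Real.sinh_eq, Real.cosh_eq, neg_add, neg_neg, Real.exp_add, Real.exp_neg]
  have h1 := Real.exp_pos y
  have h2 := Real.exp_pos (b * y)
  field_simp
  ring

/-- The derivative of the binary Rényi entropy with respect to the product of the two
probabilities, up to a positive factor, as a function of half the log-odds. -/
theorem monotoneOn_hyperbolic_ratio {b : ℝ} (hb : -1 ≤ b) (hb' : b ^ 2 + 3 * b ≤ 1) :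
    MonotoneOn (fun y => Real.sinh (b * y) * Real.cosh y ^ 2
      / (Real.sinh y * Real.cosh ((1 + b) * y)) / b) (Set.Ioi 0) := by
  have hd : ∀ y ∈ Set.Ioi (0 : ℝ), HasDerivAt (fun y => Real.sinh (b * y) * Real.cosh y ^ 2
      / (Real.sinh y * Real.cosh ((1 + b) * y)) / b)
      ((b * Real.sinh (3 * y) + (b + 4) * Real.sinh y - 3 * Real.sinh ((1 + 2 * b) * y)
        - Real.sinh ((1 - 2 * b) * y)) / b *
        (Real.cosh y / (4 * (Real.sinh y * Real.cosh ((1 + b) * y)) ^ 2))) y := by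
    intro y hy
    have hs : 0 < Real.sinh y := Real.sinh_pos_iff.2 hy
    have hc := Real.cosh_pos ((1 + b) * y)
    have hl : ∀ c : ℝ, HasDerivAt (fun y => c * y) c y := fun c => by
      simpa using (hasDerivAt_id y).const_mul c
    refine (((((hl b).sinh).mul ((Real.hasDerivAt_cosh y).pow 2)).div
      ((Real.hasDerivAt_sinh y).mul (hl (1 + b)).cosh) (mul_pos hs hc).ne').div_const
        b).congr_deriv ?_
    rw [← hyperbolic_identity, div_mul_eq_mul_div]
    congr 1
    simp only [Pi.mul_apply, Pi.pow_apply, Nat.cast_ofNat]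
    field_simp
    ring
  refine monotoneOn_of_deriv_nonneg (convex_Ioi 0)
    (fun y hy => (hd y hy).continuousAt.continuousWithinAt)
    (fun y hy => (hd y (by simpa using hy)).differentiableAt.differentiableWithinAt)
    (fun y hy => ?_)
  rw [interior_Ioi] at hy
  rw [(hd y hy).deriv]
  exact mul_nonneg (hyperbolic_div_nonneg (le_of_lt hy) hb hb')
    (div_nonneg (Real.cosh_pos y).le (by positivity))

/-- The Rényi-`α` entropy, in bits, of the probability distribution `(l, 1 - l)`. -/
noncomputable def binRenyi (α l : ℝ) : ℝ :=
  if α = 1 then -(l * Real.logb 2 l + (1 - l) * Real.logb 2 (1 - l))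
  else 1 / (1 - α) * Real.logb 2 (l ^ α + (1 - l) ^ α)

theorem ratio_exp_eq (b : ℝ) {y : ℝ} (hy : 0 < y) :
    (1 + b) / b * (1 - Real.exp (-2 * y) ^ b) * (1 + Real.exp (-2 * y)) ^ 2
      / ((1 - Real.exp (-2 * y)) * (1 + Real.exp (-2 * y) ^ (1 + b)))
    = 2 * (1 + b) * (Real.sinh (b * y) * Real.cosh y ^ 2
      / (Real.sinh y * Real.cosh ((1 + b) * y)) / b) := by
  have hs : 0 < Real.sinh y := Real.sinh_pos_iff.2 hy
  have hc := Real.cosh_pos ((1 + b) * y)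
  have h1 : 1 - Real.exp (-2 * y) = 2 * Real.sinh y * Real.exp (-y) := by
    rw [Real.sinh_eq, show -2 * y = -y + -y by ring, Real.exp_add, Real.exp_neg]
    field_simp
  have h2 : 1 + Real.exp (-2 * y) = 2 * Real.cosh y * Real.exp (-y) := by
    rw [Real.cosh_eq, show -2 * y = -y + -y by ring, Real.exp_add, Real.exp_neg]
    field_simp
  have h3 : 1 - Real.exp (-2 * y) ^ b = 2 * Real.sinh (b * y) * Real.exp (-(b * y)) := by
    rw [← Real.exp_mul, Real.sinh_eq, show -2 * y * b = -(b * y) + -(b * y) by ring,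
      Real.exp_add, Real.exp_neg]
    field_simp
  have h4 : 1 + Real.exp (-2 * y) ^ (1 + b)
      = 2 * Real.cosh ((1 + b) * y) * (Real.exp (-(b * y)) * Real.exp (-y)) := by
    rw [← Real.exp_mul, Real.cosh_eq, ← Real.exp_add,
      show -(b * y) + -y = -((1 + b) * y) by ring,
      show -2 * y * (1 + b) = -((1 + b) * y) + -((1 + b) * y) by ring,
      Real.exp_add, Real.exp_neg]
    field_simp
  rw [h1, h2, h3, h4]
  have := Real.exp_pos (-y)
  have := Real.exp_pos (-(b * y))
  rw [show (1 + b) / b * (2 * Real.sinh (b * y) * Real.exp (-(b * y)))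
      * (2 * Real.cosh y * Real.exp (-y)) ^ 2 = ((1 + b) * (2 * Real.sinh (b * y) * Real.exp (-(b * y)))
      * (2 * Real.cosh y * Real.exp (-y)) ^ 2) / b by ring, div_right_comm, ← mul_div_assoc]
  congr 1
  field_simp

/-- The substitution `t = exp (-2y)` reverses order and carries this function to a nonnegative
multiple of the hyperbolic ratio. -/
theorem antitoneOn_ratio {b : ℝ} (hb : -1 ≤ b) (hb' : b ^ 2 + 3 * b ≤ 1) :
    AntitoneOn (fun t : ℝ => (1 + b) / b * (1 - t ^ b) * (1 + t) ^ 2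
      / ((1 - t) * (1 + t ^ (1 + b)))) (Set.Ioo 0 1) := by
  have key : ∀ t ∈ Set.Ioo (0 : ℝ) 1, 0 < -Real.log t / 2 ∧
      t = Real.exp (-2 * (-Real.log t / 2)) := fun t ht => by
    refine ⟨by linarith [Real.log_neg ht.1 ht.2], ?_⟩
    rw [show -2 * (-Real.log t / 2) = Real.log t by ring, Real.exp_log ht.1]
  intro s hs t ht hst
  obtain ⟨hs0, hs1⟩ := key s hs
  obtain ⟨ht0, ht1⟩ := key t ht
  have hle : -Real.log t / 2 ≤ -Real.log s / 2 := by
    linarith [Real.log_le_log hs.1 hst]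
  generalize -Real.log s / 2 = x at *
  generalize -Real.log t / 2 = y at *
  subst hs1 ht1
  simp only [ratio_exp_eq b hs0, ratio_exp_eq b ht0]
  exact mul_le_mul_of_nonneg_left (monotoneOn_hyperbolic_ratio hb hb' ht0 hs0 hle) (by linarith)

/-- If `f' / g'` is antitone and `f`, `g` vanish at `0`, then `f / g` is antitone. -/
theorem mul_le_mul_of_antitoneOn_deriv_ratio {f g V g' : ℝ → ℝ} {s t : ℝ} (hs : 0 < s)
    (hst : s < t) (hf : ContinuousOn f (Set.Icc 0 t)) (hg : ContinuousOn g (Set.Icc 0 t))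
    (hf' : ∀ x ∈ Set.Ioo 0 t, HasDerivAt f (V x * g' x) x)
    (hg' : ∀ x ∈ Set.Ioo 0 t, HasDerivAt g (g' x) x) (hpos : ∀ x ∈ Set.Ioo 0 t, 0 < g' x)
    (hV : AntitoneOn V (Set.Ioo 0 t)) (hf0 : f 0 = 0) (hg0 : g 0 = 0)
    (hgs : 0 ≤ g s) (hgt : g s ≤ g t) : f t * g s ≤ f s * g t := by
  obtain ⟨c, hc, h1⟩ := exists_ratio_hasDerivAt_eq_ratio_slope f (fun x => V x * g' x) hs
    (hf.mono (Set.Icc_subset_Icc_right hst.le))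
    (fun x hx => hf' x ⟨hx.1, hx.2.trans hst⟩) g g' (hg.mono (Set.Icc_subset_Icc_right hst.le))
    (fun x hx => hg' x ⟨hx.1, hx.2.trans hst⟩)
  obtain ⟨e, he, h2⟩ := exists_ratio_hasDerivAt_eq_ratio_slope f (fun x => V x * g' x) hst
    (hf.mono (Set.Icc_subset_Icc_left hs.le))
    (fun x hx => hf' x ⟨hs.trans hx.1, hx.2⟩) g g' (hg.mono (Set.Icc_subset_Icc_left hs.le))
    (fun x hx => hg' x ⟨hs.trans hx.1, hx.2⟩)
  have hc' : c ∈ Set.Ioo 0 t := ⟨hc.1, hc.2.trans hst⟩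
  have he' : e ∈ Set.Ioo 0 t := ⟨hs.trans he.1, he.2⟩
  have hV' : V e ≤ V c := hV hc' he' (hc.2.trans he.1).le
  rw [hf0, hg0, sub_zero, sub_zero, ← mul_assoc] at h1
  rw [← mul_assoc] at h2
  have h1' := mul_right_cancel₀ (hpos c hc').ne' h1
  have h2' := mul_right_cancel₀ (hpos e he').ne' h2
  -- By Cauchy's mean value theorem `f s = V c * g s`, while the slope over `[s, t]` is `V e ≤ V c`.
  have h3 : f t - f s ≤ V c * (g t - g s) := by
    rw [← h2', mul_comm]; exact mul_le_mul_of_nonneg_right hV' (by linarith)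
  nlinarith

/-- In the odds `t = l / (1 - l)`, the left factor is the binary entropy in nats and `t / (1 + t) ^
2` is `l (1 - l)`. The quotient of their derivatives is the function of `antitoneOn_ratio`. -/
theorem renyi_logodds_ratio {b s t : ℝ} (hb : -1 < b) (hb0 : b ≠ 0) (hb' : b ^ 2 + 3 * b ≤ 1)
    (hs : 0 < s) (hst : s < t) (ht : t ≤ 1) :
    ((1 + b) * Real.log (1 + t) - Real.log (1 + t ^ (1 + b))) / b * (s / (1 + s) ^ 2)
      ≤ ((1 + b) * Real.log (1 + s) - Real.log (1 + s ^ (1 + b))) / b * (t / (1 + t) ^ 2) := by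
  have hb1 : 0 < 1 + b := by linarith
  have hmono : ∀ x y : ℝ, 0 ≤ x → x ≤ y → y ≤ 1 → x / (1 + x) ^ 2 ≤ y / (1 + y) ^ 2 := by
    intro x y hx hxy hy
    have hy0 := hx.trans hxy
    rw [div_le_div_iff₀ (by positivity) (by positivity)]
    nlinarith [mul_nonneg (sub_nonneg.2 hxy) (sub_nonneg.2 (mul_le_one₀ (hxy.trans hy)
      (hx.trans hxy) hy))]
  refine mul_le_mul_of_antitoneOn_deriv_ratio
    (f := fun t => ((1 + b) * Real.log (1 + t) - Real.log (1 + t ^ (1 + b))) / b)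
    (g := fun t => t / (1 + t) ^ 2) (g' := fun t => (1 - t) / (1 + t) ^ 3)
    (V := fun t : ℝ => (1 + b) / b * (1 - t ^ b) * (1 + t) ^ 2
      / ((1 - t) * (1 + t ^ (1 + b)))) hs hst ?_ ?_ ?_ ?_ ?_ ?_ ?_ ?_ ?_ ?_
  · have h1 : ∀ x ∈ Set.Icc 0 t, (1 + x : ℝ) ≠ 0 := fun x hx => by linarith [hx.1]
    have h2 : ∀ x ∈ Set.Icc 0 t, (1 + x ^ (1 + b) : ℝ) ≠ 0 := fun x hx => by
      have := Real.rpow_nonneg hx.1 (1 + b); linarith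
    have h3 : ContinuousOn (fun x : ℝ => x ^ (1 + b)) (Set.Icc 0 t) :=
      (Real.continuous_rpow_const hb1.le).continuousOn
    exact ((((continuousOn_const.add continuousOn_id).log h1).const_mul _).sub
      ((continuousOn_const.add h3).log h2)).div_const _
  · refine ContinuousOn.div (by fun_prop) (by fun_prop) fun x hx => ?_
    have := hx.1
    positivity
  · intro x hx
    have hx0 := hx.1
    have hx1 : 0 < 1 - x := by linarith [hx.2]
    have hp := Real.rpow_pos_of_pos hx0 b
    have e1 : x ^ (1 + b) = x * x ^ b := by rw [Real.rpow_add hx0, Real.rpow_one]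
    have h0 : HasDerivAt (fun x : ℝ => 1 + x) 1 x := by simpa using (hasDerivAt_id x).const_add 1
    have h1 : HasDerivAt (fun x : ℝ => 1 + x ^ (1 + b)) ((1 + b) * x ^ b) x := by
      have := (Real.hasDerivAt_rpow_const (p := 1 + b) (Or.inl hx0.ne')).const_add 1
      simpa using this
    refine ((((h0.log (by positivity)).const_mul (1 + b)).sub
      (h1.log (by positivity))).div_const b).congr_deriv ?_
    rw [e1]
    field_simp
    ring
  · intro x hx
    have hx0 := hx.1
    have h0 : HasDerivAt (fun x : ℝ => 1 + x) 1 x := by simpa using (hasDerivAt_id x).const_add 1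
    refine ((hasDerivAt_id x).div (h0.pow 2) (show (1 + x) ^ 2 ≠ 0 by positivity)).congr_deriv ?_
    simp
    field_simp
    ring
  · intro x hx
    have := hx.1
    have : 0 < 1 - x := by linarith [hx.2]
    positivity
  · exact (antitoneOn_ratio hb.le hb').mono (Set.Ioo_subset_Ioo_right ht)
  · simp [hb1.ne']
  · simp
  · positivity
  · exact hmono s t hs.le hst.le ht

theorem binRenyi_logodds {α t : ℝ} (hα : α ≠ 1) (ht : 0 < t) :
    binRenyi α (t / (1 + t)) =
      ((1 + (α - 1)) * Real.log (1 + t) - Real.log (1 + t ^ (1 + (α - 1)))) / (α - 1)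
        / Real.log 2 := by
  have h1 : 1 - t / (1 + t) = 1 / (1 + t) := by field_simp; ring
  have h2 : (t / (1 + t)) ^ α + (1 / (1 + t)) ^ α = (1 + t ^ α) / (1 + t) ^ α := by
    rw [Real.div_rpow ht.le (by positivity), Real.div_rpow zero_le_one (by positivity),
      Real.one_rpow]
    ring
  have h3 := Real.rpow_pos_of_pos ht α
  have h4 : α - 1 ≠ 0 := sub_ne_zero.2 hα
  have h5 : 1 - α ≠ 0 := sub_ne_zero.2 hα.symm
  rw [binRenyi, if_neg hα, h1, h2, Real.logb, Real.log_div (by positivity) (by positivity),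
    Real.log_rpow (by positivity)]
  have : 1 / (1 - α) = -(1 / (α - 1)) := by rw [← neg_sub α 1, one_div, one_div, neg_inv]
  rw [this, add_sub_cancel]
  ring

theorem binRenyi_ratio_of_ne_one {α l m : ℝ} (hα0 : 0 < α) (hα1 : α ≠ 1)
    (hα : α ^ 2 + α ≤ 3) (hl : 0 < l) (hlm : l ≤ m) (hm : m ≤ 1 / 2) :
    binRenyi α m * (l * (1 - l)) ≤ binRenyi α l * (m * (1 - m)) := by
  rcases hlm.eq_or_lt with rfl | hlm
  · rfl
  have key : ∀ x : ℝ, 0 < x → x < 1 → x = (x / (1 - x)) / (1 + x / (1 - x)) ∧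
      x * (1 - x) = (x / (1 - x)) / (1 + x / (1 - x)) ^ 2 := by
    intro x h0 h1
    have : 0 < 1 - x := by linarith
    have e : 1 + x / (1 - x) = 1 / (1 - x) := by field_simp; ring
    rw [e]
    constructor <;> field_simp
  obtain ⟨hl1, hl2⟩ := key l hl (by linarith)
  obtain ⟨hm1, hm2⟩ := key m (by linarith) (by linarith)
  have hs : 0 < l / (1 - l) := div_pos hl (by linarith)
  have hst : l / (1 - l) < m / (1 - m) := by
    rw [div_lt_div_iff₀ (by linarith) (by linarith)]; nlinarith
  have ht : m / (1 - m) ≤ 1 := by rw [div_le_one (by linarith)]; linarith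
  have el := congrArg (binRenyi α) hl1
  have em := congrArg (binRenyi α) hm1
  rw [binRenyi_logodds hα1 hs] at el
  rw [binRenyi_logodds hα1 (hs.trans hst)] at em
  rw [el, em, hl2, hm2]
  have h := div_le_div_of_nonneg_right (renyi_logodds_ratio (b := α - 1) (by linarith)
    (sub_ne_zero.2 hα1) (by nlinarith) hs hst ht) (Real.log_pos one_lt_two).le
  exact (le_of_eq (by ring)).trans (h.trans (le_of_eq (by ring)))

/-- For `α ≠ 1` the entropy is minus the slope, between `1` and `α`, of `α ↦ logb 2 (l ^ α + (1 - l)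
^ α)`, which vanishes at `1`. -/
theorem tendsto_binRenyi_one {l : ℝ} (hl : 0 < l) (hl' : l < 1) :
    Filter.Tendsto (fun α => binRenyi α l) (nhdsWithin 1 {1}ᶜ) (nhds (binRenyi 1 l)) := by
  have hu : 0 < 1 - l := by linarith
  have h1 : HasDerivAt (fun α : ℝ => Real.logb 2 (l ^ α + (1 - l) ^ α))
      (l * Real.logb 2 l + (1 - l) * Real.logb 2 (1 - l)) 1 := by
    have h := (((hasDerivAt_id (1 : ℝ)).const_rpow hl).add
      ((hasDerivAt_id (1 : ℝ)).const_rpow hu)).log (by simp)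
    have h' := h.div_const (Real.log 2)
    refine h'.congr_deriv ?_
    simp [Real.logb]
    ring
  have h2 := h1.tendsto_slope.neg
  rw [binRenyi, if_pos rfl]
  refine h2.congr' ?_
  filter_upwards [self_mem_nhdsWithin] with α hα
  have hα : α ≠ 1 := hα
  rw [binRenyi, if_neg hα, slope_def_field]
  simp
  rw [← neg_sub α 1, inv_neg]
  ring

theorem binRenyi_ratio {α l m : ℝ} (hα0 : 0 < α) (hα : α ^ 2 + α ≤ 3) (hl : 0 < l)
    (hlm : l ≤ m) (hm : m ≤ 1 / 2) :
    binRenyi α m * (l * (1 - l)) ≤ binRenyi α l * (m * (1 - m)) := by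
  by_cases hα1 : α = 1
  · subst hα1
    refine le_of_tendsto_of_tendsto
      ((tendsto_binRenyi_one (l := m) (by linarith) (by linarith)).mul_const _)
      ((tendsto_binRenyi_one (l := l) (by linarith) (by linarith)).mul_const _) ?_
    -- Any neighbourhood of `1` on which `α > 0` and `α ^ 2 + α ≤ 3` would serve.
    have : Set.Ioo (1 / 2 : ℝ) (5 / 4) ∈ nhds (1 : ℝ) := Ioo_mem_nhds (by norm_num) (by norm_num)
    filter_upwards [self_mem_nhdsWithin, mem_nhdsWithin_of_mem_nhds this] with α h1 h2
    exact binRenyi_ratio_of_ne_one (by linarith [h2.1]) h1 (by nlinarith [h2.1, h2.2]) hl hlm hm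
  · exact binRenyi_ratio_of_ne_one hα0 hα1 hα hl hlm hm

theorem binRenyi_zero {α : ℝ} (hα : 0 < α) : binRenyi α 0 = 0 := by
  simp [binRenyi, hα.ne']

theorem binRenyi_nonneg {α l : ℝ} (hα : 0 < α) (h0 : 0 ≤ l) (h1 : l ≤ 1) :
    0 ≤ binRenyi α l := by
  rcases h0.eq_or_lt with rfl | h0
  · simp [binRenyi, hα.ne']
  rcases h1.eq_or_lt with rfl | h1
  · simp [binRenyi, hα.ne']
  have hu : 0 < 1 - l := by linarith
  rw [binRenyi]
  split_ifs with hα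
  · have a1 := Real.logb_neg (b := 2) (by norm_num) h0 h1
    have a2 := Real.logb_neg (b := 2) (by norm_num) hu (by linarith)
    nlinarith
  · rcases lt_or_gt_of_ne hα with hα | hα
    · have a1 := Real.rpow_le_rpow_of_exponent_ge h0 h1.le hα.le
      have a2 := Real.rpow_le_rpow_of_exponent_ge hu (by linarith) hα.le
      rw [Real.rpow_one] at a1 a2
      exact mul_nonneg (one_div_nonneg.2 (by linarith))
        (Real.logb_nonneg (by norm_num) (by linarith))
    · have a1 := Real.rpow_le_rpow_of_exponent_ge h0 h1.le hα.le
      have a2 := Real.rpow_le_rpow_of_exponent_ge hu (by linarith) hα.le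
      rw [Real.rpow_one] at a1 a2
      have := Real.rpow_pos_of_pos h0 α
      have := Real.rpow_pos_of_pos hu α
      exact mul_nonneg_of_nonpos_of_nonpos (one_div_nonpos.2 (by linarith))
        (Real.logb_nonpos (by norm_num) (by positivity) (by linarith))

theorem continuousOn_binRenyi {α : ℝ} (hα : 0 < α) :
    ContinuousOn (binRenyi α) (Set.Icc 0 1) := by
  have hl : Continuous fun x : ℝ => x * Real.logb 2 x := by
    simpa only [Real.logb, mul_div_assoc] using Real.continuous_mul_log.div_const (Real.log 2)
  by_cases h1 : α = 1
  · have : binRenyi α = fun l => -(l * Real.logb 2 l + (1 - l) * Real.logb 2 (1 - l)) := by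
      funext l; rw [binRenyi, if_pos h1]
    rw [this]
    exact (hl.add (hl.comp (continuous_const.sub continuous_id))).neg.continuousOn
  · have : binRenyi α = fun l => 1 / (1 - α) * (Real.log (l ^ α + (1 - l) ^ α) / Real.log 2) := by
      funext l; rw [binRenyi, if_neg h1, Real.logb]
    rw [this]
    have hp : Continuous fun x : ℝ => x ^ α := Real.continuous_rpow_const hα.le
    refine continuousOn_const.mul ?_
    have hp' : Continuous fun x : ℝ => (1 - x) ^ α := hp.comp (by fun_prop)
    refine (ContinuousOn.log (hp.add hp').continuousOn fun x hx => ?_).div_const _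
    have a1 := Real.rpow_nonneg hx.1 α
    have a2 := Real.rpow_nonneg (sub_nonneg.2 hx.2) α
    rcases hx.1.eq_or_lt with h | h
    · simp only [← h]; simp [hα.ne']
    · have := Real.rpow_pos_of_pos h α
      exact (add_pos_of_pos_of_nonneg this a2).ne'

/-- The binary Rényi entropy as a function of the product of the two probabilities. -/
noncomputable def productRenyi (α D : ℝ) : ℝ := binRenyi α ((1 - √(1 - 4 * D)) / 2)

theorem productRenyi_mul (α : ℝ) {l : ℝ} (hl : l ≤ 1 / 2) :
    productRenyi α (l * (1 - l)) = binRenyi α l := by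
  rw [productRenyi, show 1 - 4 * (l * (1 - l)) = (1 - 2 * l) ^ 2 by ring,
    Real.sqrt_sq (by linarith)]
  ring_nf

theorem exists_mul_one_sub {D : ℝ} (h0 : 0 ≤ D) (h1 : D ≤ 1 / 4) :
    ∃ l, 0 ≤ l ∧ l ≤ 1 / 2 ∧ D = l * (1 - l) := by
  refine ⟨(1 - √(1 - 4 * D)) / 2, ?_, ?_, ?_⟩
  · have : √(1 - 4 * D) ≤ 1 := Real.sqrt_le_one.2 (by linarith)
    linarith
  · linarith [Real.sqrt_nonneg (1 - 4 * D)]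
  · have := Real.sq_sqrt (show 0 ≤ 1 - 4 * D by linarith)
    linarith

theorem productRenyi_zero {α : ℝ} (hα : 0 < α) : productRenyi α 0 = 0 := by
  simp [productRenyi, binRenyi_zero hα]

theorem productRenyi_nonneg {α D : ℝ} (hα : 0 < α) (h0 : 0 ≤ D) (h1 : D ≤ 1 / 4) : 0 ≤ productRenyi α D := by
  obtain ⟨l, hl0, hl1, rfl⟩ := exists_mul_one_sub h0 h1
  rw [productRenyi_mul α hl1]
  exact binRenyi_nonneg hα hl0 (by linarith)

theorem exists_productRenyi_le {α : ℝ} (hα : 0 < α) :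
    ∃ C, ∀ D, 0 ≤ D → D ≤ 1 / 4 → productRenyi α D ≤ C := by
  obtain ⟨C, hC⟩ := isCompact_Icc.exists_bound_of_continuousOn (continuousOn_binRenyi hα)
  refine ⟨C, fun D h0 h1 => ?_⟩
  obtain ⟨l, hl0, hl1, rfl⟩ := exists_mul_one_sub h0 h1
  rw [productRenyi_mul α hl1]
  exact (le_abs_self _).trans (hC l ⟨hl0, by linarith⟩)

theorem productRenyi_ratio {α D E : ℝ} (hα0 : 0 < α) (hα : α ^ 2 + α ≤ 3) (hD : 0 ≤ D)
    (hDE : D ≤ E) (hE : E ≤ 1 / 4) : productRenyi α E * D ≤ productRenyi α D * E := by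
  rcases hD.eq_or_lt with rfl | hD0
  · simp [productRenyi_zero hα0]
  obtain ⟨l, hl0, hl1, rfl⟩ := exists_mul_one_sub hD (hDE.trans hE)
  obtain ⟨m, hm0, hm1, rfl⟩ := exists_mul_one_sub (hD.trans hDE) hE
  rw [productRenyi_mul α hl1, productRenyi_mul α hm1]
  have : 0 < l := hl0.lt_of_ne (by rintro rfl; simp at hD0)
  refine binRenyi_ratio hα0 hα this ?_ hm1
  by_contra! h
  nlinarith

/-- With `S` the total, the ratio bound gives `h(D i) ≥ (D i / S) h(S)`; summing over `i` gives the
claim. -/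
theorem productRenyi_sum_le {α : ℝ} (hα0 : 0 < α) (hα : α ^ 2 + α ≤ 3) {ι : Type*}
    (s : Finset ι) (D : ι → ℝ) (hD : ∀ i ∈ s, 0 ≤ D i) (hs : ∑ i ∈ s, D i ≤ 1 / 4) :
    productRenyi α (∑ i ∈ s, D i) ≤ ∑ i ∈ s, productRenyi α (D i) := by
  have hle : ∀ i ∈ s, D i ≤ ∑ i ∈ s, D i := fun i hi => Finset.single_le_sum hD hi
  rcases (Finset.sum_nonneg hD).eq_or_lt with h | h
  · rw [← h, productRenyi_zero hα0]
    exact Finset.sum_nonneg fun i hi => productRenyi_nonneg hα0 (hD i hi) ((hle i hi).trans hs)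
  · refine le_of_mul_le_mul_right ?_ h
    rw [Finset.sum_mul]
    rw [Finset.mul_sum]
    exact Finset.sum_le_sum fun i hi => productRenyi_ratio hα0 hα (hD i hi) (hle i hi) hs

/-! ### The entropy of a state of rank two -/

/-- At most two nonzero values are determined by their sum and their sum of squares. The condition
`g 0 = 0` discards the zero eigenvalues, so one statement serves `x log x` and `x ^ α`. -/
theorem exists_two_values {ι : Type*} [Fintype ι] (e : ι → ℝ) {D : ℝ} (hD : 0 ≤ D)
    (h1 : ∑ i, e i = 1) (h2 : ∑ i, e i ^ 2 = 1 - 2 * D)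
    (hc : (Finset.univ.filter fun i => e i ≠ 0).card ≤ 2) :
    ∃ l, l ≤ 1 / 2 ∧ D = l * (1 - l) ∧
      ∀ g : ℝ → ℝ, g 0 = 0 → ∑ i, g (e i) = g l + g (1 - l) := by
  classical
  have key : ∀ g : ℝ → ℝ, g 0 = 0 →
      ∑ i, g (e i) = ∑ i ∈ Finset.univ.filter (fun i => e i ≠ 0), g (e i) := by
    intro g hg
    rw [Finset.sum_filter]
    refine Finset.sum_congr rfl fun i _ => ?_
    by_cases h : e i = 0 <;> simp [h, hg]
  rw [key (fun x => x) rfl] at h1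
  rw [key (fun x => x ^ 2) (by simp)] at h2
  generalize Finset.univ.filter (fun i => e i ≠ 0) = T at *
  interval_cases hT : T.card
  · simp [Finset.card_eq_zero.1 hT] at h1
  · obtain ⟨i, rfl⟩ := Finset.card_eq_one.1 hT
    simp only [Finset.sum_singleton] at h1 h2 key
    rw [h1] at h2
    refine ⟨0, by norm_num, by linarith, fun g hg => ?_⟩
    rw [key g hg, h1, hg]; simp
  · obtain ⟨i, j, hij, rfl⟩ := Finset.card_eq_two.1 hT
    simp only [Finset.sum_pair hij] at h1 h2 key
    have hj : e j = 1 - e i := by linarith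
    rw [hj] at h2
    rcases le_total (e i) (1 / 2) with h | h
    · refine ⟨e i, h, by nlinarith, fun g hg => ?_⟩
      rw [key g hg, hj]
    · refine ⟨1 - e i, by linarith, by nlinarith, fun g hg => ?_⟩
      rw [key g hg, hj, sub_sub_cancel, add_comm]

theorem trace_mul_self_eq_sum_eigenvalues {A : Type*} [Fintype A] [DecidableEq A]
    {ρ : Matrix A A ℂ} (hρ : ρ.IsHermitian) :
    (ρ * ρ).trace = ∑ i, ((hρ.eigenvalues i ^ 2 : ℝ) : ℂ) := by
  conv_lhs => rw [hρ.spectral_theorem]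
  rw [← map_mul, Unitary.conjStarAlgAut_apply, Matrix.trace_mul_cycle, Unitary.coe_star_mul_self,
    one_mul, Matrix.diagonal_mul_diagonal, Matrix.trace_diagonal]
  simp [sq]

theorem renyiEntropy_eq_of_two_values {A : Type*} [Fintype A] [DecidableEq A] {α l : ℝ}
    (hα : 0 < α) {ρ : Matrix A A ℂ} (hρ : ρ.IsHermitian)
    (h : ∀ g : ℝ → ℝ, g 0 = 0 → ∑ i, g (hρ.eigenvalues i) = g l + g (1 - l)) :
    renyiEntropy α ρ hρ = binRenyi α l := by
  rw [renyiEntropy, binRenyi, h (fun x => x * Real.logb 2 x) (by simp),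
    h (fun x => x ^ α) (by simp [hα.ne'])]

theorem star_dotProduct_self {A : Type*} [Fintype A] (v : A → ℂ) :
    star v ⬝ᵥ v = ((∑ x, ‖v x‖ ^ 2 : ℝ) : ℂ) := by
  simp [dotProduct, Complex.conj_mul']

theorem rank_add_le {A : Type*} [Fintype A] (M N : Matrix A A ℂ) :
    (M + N).rank ≤ M.rank + N.rank := by
  refine (Submodule.finrank_mono (t := M.mulVecLin.range ⊔ N.mulVecLin.range) ?_).trans
    (Submodule.finrank_add_le_finrank_add_finrank _ _)
  rintro _ ⟨x, rfl⟩
  rw [Matrix.mulVecLin_add, LinearMap.add_apply]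
  exact Submodule.add_mem_sup ⟨x, rfl⟩ ⟨x, rfl⟩

/-- The rank is at most two and the trace is 1. With `a` the weight of `v` off `a₀`, the purity is
`(1 - β)² + β² + 2β (1 - β - a) = 1 - 2aβ`, so `aβ` is the product of the two eigenvalues. -/
theorem renyiEntropy_proj_add {A : Type*} [Fintype A] [DecidableEq A] {α : ℝ} (hα : 0 < α)
    {ρ : Matrix A A ℂ} (hρ : ρ.IsHermitian) (v : A → ℂ) (a₀ : A) {β : ℝ} (hβ : 0 ≤ β)
    (h : ρ = proj v + (β : ℂ) • proj (Pi.single a₀ 1)) (hv : ∑ x, ‖v x‖ ^ 2 + β = 1) :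
    renyiEntropy α ρ hρ = productRenyi α ((∑ x ∈ Finset.univ.erase a₀, ‖v x‖ ^ 2) * β) := by
  have hs := Finset.add_sum_erase Finset.univ (fun x => ‖v x‖ ^ 2) (Finset.mem_univ a₀)
  set a := ∑ x ∈ Finset.univ.erase a₀, ‖v x‖ ^ 2 with ha
  have ha0 : 0 ≤ a := Finset.sum_nonneg fun _ _ => by positivity
  have e1 : star v ⬝ᵥ v = ((1 - β : ℝ) : ℂ) := by
    rw [star_dotProduct_self]; congr 1; linarith
  have e2 : v ⬝ᵥ star v = ((1 - β : ℝ) : ℂ) := by rw [dotProduct_comm, e1]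
  have e3 : v a₀ * star (v a₀) = ((1 - β - a : ℝ) : ℂ) := by
    rw [Complex.star_def, Complex.mul_conj']; norm_cast; linarith
  have htr : ρ.trace = 1 := by
    rw [h]
    simp [proj, Matrix.trace_vecMulVec, e2]
  have htr2 : (ρ * ρ).trace = ((1 - 2 * (a * β) : ℝ) : ℂ) := by
    rw [h]
    simp only [proj, add_mul, mul_add, Matrix.vecMulVec_mul_vecMulVec, Matrix.smul_mul,
      Matrix.mul_smul, Matrix.trace_add, Matrix.trace_smul, Matrix.trace_vecMulVec, e1]
    simp only [dotProduct_smul, e2]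
    simp
    have e4 : (starRingEnd ℂ) (v a₀) * v a₀ = ((1 - β - a : ℝ) : ℂ) := by rw [← e3, mul_comm]; rfl
    have e5 : v a₀ * (starRingEnd ℂ) (v a₀) = ((1 - β - a : ℝ) : ℂ) := e3
    rw [e4, e5]
    push_cast
    ring
  rw [hρ.trace_eq_sum_eigenvalues] at htr
  rw [trace_mul_self_eq_sum_eigenvalues hρ] at htr2
  have hc : (Finset.univ.filter fun i => hρ.eigenvalues i ≠ 0).card ≤ 2 := by
    rw [← Fintype.card_subtype, ← hρ.rank_eq_card_non_zero_eigs, h]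
    refine (rank_add_le _ _).trans ?_
    have hr1 : (proj v).rank ≤ 1 := Matrix.rank_vecMulVec_le _ _
    have hr2 : ((β : ℂ) • proj (Pi.single a₀ 1 : A → ℂ)).rank ≤ 1 := by
      rw [proj, ← Matrix.smul_vecMulVec]; exact Matrix.rank_vecMulVec_le _ _
    omega
  obtain ⟨l, hl, hD, hg⟩ := exists_two_values hρ.eigenvalues (mul_nonneg ha0 hβ)
    (Complex.ofReal_injective (by rw [Complex.ofReal_sum]; simpa using htr)) (by exact_mod_cast htr2) hc
  rw [renyiEntropy_eq_of_two_values hα hρ hg, hD, productRenyi_mul α hl]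

/-! ### Pure states with at most one excited side -/

theorem sum_prod_of_support {A B M : Type*} [Fintype A] [Fintype B] [DecidableEq B]
    [AddCommMonoid M] {a₀ : A} {b₀ : B} (f : A × B → M)
    (hf : ∀ x y, x ≠ a₀ → y ≠ b₀ → f (x, y) = 0) :
    ∑ w, f w = ∑ x, f (x, b₀) + ∑ y ∈ Finset.univ.erase b₀, f (a₀, y) := by
  rw [Fintype.sum_prod_type_right, ← Finset.add_sum_erase _ _ (Finset.mem_univ b₀)]
  congr 1
  refine Finset.sum_congr rfl fun y hy => ?_
  exact Fintype.sum_eq_single a₀ fun x hx => hf x y hx (Finset.ne_of_mem_erase hy)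

/-- A bipartite pure state with at most one excited side has a reduced state that is a mixture of
a pure state and the vacuum. -/
theorem traceRight_proj {A B : Type*} [DecidableEq A] [Fintype B] [DecidableEq B] {a₀ : A} {b₀ : B}
    {φ : A × B → ℂ} (hφ : ∀ x y, x ≠ a₀ → y ≠ b₀ → φ (x, y) = 0) :
    traceRight (proj φ) = proj (fun x => φ (x, b₀)) +
      ((∑ y ∈ Finset.univ.erase b₀, ‖φ (a₀, y)‖ ^ 2 : ℝ) : ℂ) • proj (Pi.single a₀ 1) := by
  ext x x'
  simp only [traceRight, proj, Matrix.of_apply, Matrix.vecMulVec_apply, Pi.star_apply,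
    Matrix.add_apply, Matrix.smul_apply, smul_eq_mul]
  rw [← Finset.add_sum_erase _ _ (Finset.mem_univ b₀)]
  congr 1
  push_cast
  rw [Finset.sum_mul]
  refine Finset.sum_congr rfl fun y hy => ?_
  have hy := Finset.ne_of_mem_erase hy
  by_cases hx : x = a₀
  · by_cases hx' : x' = a₀
    · subst hx hx'; simp [Complex.mul_conj']
    · simp [hφ x' y hx' hy, hx']
  · simp [hφ x y hx hy, hx]

section Bipartite

variable {A B : Type*} [Fintype A] [DecidableEq A] [Fintype B] [DecidableEq B]

/-- The product of the weights of the excitations on the two sides of a bipartite pure state. -/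
noncomputable def weightProd (a₀ : A) (b₀ : B) (φ : A × B → ℂ) : ℝ :=
  (∑ x ∈ Finset.univ.erase a₀, ‖φ (x, b₀)‖ ^ 2) * ∑ y ∈ Finset.univ.erase b₀, ‖φ (a₀, y)‖ ^ 2

theorem weightProd_nonneg (a₀ : A) (b₀ : B) (φ : A × B → ℂ) : 0 ≤ weightProd a₀ b₀ φ :=
  mul_nonneg (Finset.sum_nonneg fun _ _ => by positivity)
    (Finset.sum_nonneg fun _ _ => by positivity)

theorem weightProd_le {a₀ : A} {b₀ : B} {φ : A × B → ℂ} (h1 : IsUnitVec φ)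
    (hφ : ∀ x y, x ≠ a₀ → y ≠ b₀ → φ (x, y) = 0) : weightProd a₀ b₀ φ ≤ 1 / 4 := by
  have h := sum_prod_of_support (fun w => ‖φ w‖ ^ 2) (a₀ := a₀) (b₀ := b₀)
    (fun x y hx hy => by simp [hφ x y hx hy])
  rw [IsUnitVec] at h1
  rw [h1, ← Finset.add_sum_erase _ _ (Finset.mem_univ a₀)] at h
  have := sq_nonneg ‖φ (a₀, b₀)‖
  have h2 : 0 ≤ ∑ x ∈ Finset.univ.erase a₀, ‖φ (x, b₀)‖ ^ 2 :=
    Finset.sum_nonneg fun _ _ => by positivity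
  have h3 : 0 ≤ ∑ y ∈ Finset.univ.erase b₀, ‖φ (a₀, y)‖ ^ 2 :=
    Finset.sum_nonneg fun _ _ => by positivity
  rw [weightProd]
  nlinarith [sq_nonneg (∑ x ∈ Finset.univ.erase a₀, ‖φ (x, b₀)‖ ^ 2
    - ∑ y ∈ Finset.univ.erase b₀, ‖φ (a₀, y)‖ ^ 2)]

theorem renyiEntanglement_eq {α : ℝ} (hα : 0 < α) {a₀ : A} {b₀ : B} {φ : A × B → ℂ}
    (h1 : IsUnitVec φ) (hφ : ∀ x y, x ≠ a₀ → y ≠ b₀ → φ (x, y) = 0) :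
    renyiEntanglement α φ = productRenyi α (weightProd a₀ b₀ φ) := by
  refine renyiEntropy_proj_add hα _ (fun x => φ (x, b₀)) a₀
    (Finset.sum_nonneg fun _ _ => by positivity) ?_ ?_
  · exact traceRight_proj hφ
  · rw [← h1, sum_prod_of_support (fun w => ‖φ w‖ ^ 2) (a₀ := a₀) (b₀ := b₀)
      (fun x y hx hy => by simp [hφ x y hx hy])]

theorem exists_orthogonal_phase (c : ℂ) : ∃ η : ℂ, ‖η‖ = 1 ∧ (c * star η).re = 0 := by
  by_cases hc : c = 0
  · exact ⟨1, by simp [hc]⟩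
  · have hn : (‖c‖ : ℂ) ≠ 0 := by simpa using hc
    refine ⟨Complex.I * c / ‖c‖, by simp [hc], ?_⟩
    have : c * star (Complex.I * c / ‖c‖) = ((‖c‖ : ℝ) : ℂ) * -Complex.I := by
      simp only [star_div₀, star_mul', Complex.star_def, Complex.conj_I, Complex.conj_ofReal]
      rw [show c * (-Complex.I * (starRingEnd ℂ) c / (‖c‖ : ℂ))
        = c * (starRingEnd ℂ) c * -Complex.I / ‖c‖ by ring, Complex.mul_conj']
      field_simp
    rw [this]; simp

/-- Mixing a pure state with the vacuum: the mixture is an equal-weight ensemble of two pure states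
that differ only in their vacuum amplitudes. -/
theorem exists_vacuum_ensemble {X : Type*} [Fintype X] [DecidableEq X] (o : X) (φ : X → ℂ) {w : ℝ}
    (hw : 0 ≤ w) (h1 : ∑ x, ‖φ x‖ ^ 2 + w = 1) :
    ∃ χ : Fin 2 → X → ℂ, (∀ s, IsUnitVec (χ s)) ∧ (∀ s x, x ≠ o → χ s x = φ x) ∧
      ∑ s, (1 / 2 : ℂ) • proj (χ s) = proj φ + (w : ℂ) • proj (Pi.single o 1) := by
  obtain ⟨η, hη, hre⟩ := exists_orthogonal_phase (φ o)
  have hsq : (√w : ℂ) * √w = w := by exact_mod_cast Real.mul_self_sqrt hw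
  have hηη : η * star η = 1 := by rw [Complex.star_def, Complex.mul_conj', hη]; simp
  -- Averaging over `σ = ±1` cancels the cross terms. The phase `η` is orthogonal to `φ o`, so both
  -- signs give norm one.
  let χ : ℝ → X → ℂ := fun σ => φ + Pi.single o ((σ * √w : ℝ) * η)
  have hne : ∀ σ x, x ≠ o → χ σ x = φ x := fun σ x hx => by simp [χ, hx]
  have hunit : ∀ σ : ℝ, σ ^ 2 = 1 → IsUnitVec (χ σ) := by
    intro σ hσ
    have hnorm : ‖φ o + (σ * √w : ℝ) * η‖ ^ 2 = ‖φ o‖ ^ 2 + w := by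
      have h3 : ‖((σ * √w : ℝ) : ℂ) * η‖ ^ 2 = w := by
        rw [norm_mul, hη, mul_one, Complex.norm_real, Real.norm_eq_abs, sq_abs, mul_pow, hσ,
          Real.sq_sqrt hw, one_mul]
      have h4 : (φ o * (starRingEnd ℂ) (((σ * √w : ℝ) : ℂ) * η)).re = 0 := by
        rw [map_mul, Complex.conj_ofReal, mul_left_comm, Complex.re_ofReal_mul]
        exact mul_eq_zero_of_right _ hre
      rw [← Complex.normSq_eq_norm_sq, Complex.normSq_add, Complex.normSq_eq_norm_sq,
        Complex.normSq_eq_norm_sq, h3, h4]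
      ring
    rw [IsUnitVec, ← h1, ← Finset.add_sum_erase _ _ (Finset.mem_univ o),
      ← Finset.add_sum_erase _ _ (Finset.mem_univ o)]
    have : ∑ x ∈ Finset.univ.erase o, ‖χ σ x‖ ^ 2 = ∑ x ∈ Finset.univ.erase o, ‖φ x‖ ^ 2 :=
      Finset.sum_congr rfl fun x hx => by rw [hne σ x (Finset.ne_of_mem_erase hx)]
    rw [this, show χ σ o = φ o + (σ * √w : ℝ) * η by simp [χ], hnorm]
    ring
  refine ⟨![χ 1, χ (-1)], ?_, ?_, ?_⟩
  · intro s
    fin_cases s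
    · exact hunit 1 (by norm_num)
    · exact hunit (-1) (by norm_num)
  · intro s x hx
    fin_cases s
    · exact hne 1 x hx
    · exact hne (-1) x hx
  · ext x y
    simp only [Fin.sum_univ_two, Matrix.cons_val_zero, Matrix.cons_val_one, proj,
      Matrix.add_apply, Matrix.smul_apply, Matrix.vecMulVec_apply, Pi.star_apply, smul_eq_mul]
    by_cases hx : x = o
    · by_cases hy : y = o
      · subst hx hy
        simp only [χ, Pi.add_apply, Pi.single_eq_same, star_add, star_mul', Complex.star_def,
          Complex.conj_ofReal] at *
        push_cast
        simp only [map_one]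
        linear_combination (w : ℂ) * hηη + η * (starRingEnd ℂ) η * hsq
      · subst hx
        rw [hne _ y hy, hne _ y hy]
        simp [χ, hy]
        ring
    · rw [hne _ x hx, hne _ x hx]
      by_cases hy : y = o
      · subst hy
        simp [χ, hx]
        ring
      · rw [hne _ y hy, hne _ y hy]
        simp [hx]
        ring

end Bipartite

/-! ### Bounds on the entanglement of assistance -/

/-- The diagonal entry is `∑ p i * ‖ψ i x‖ ^ 2`, a sum of nonnegative terms. -/
theorem IsPureDecomposition.apply_eq_zero {X : Type*} [Fintype X] {ρ : Matrix X X ℂ} {N : ℕ}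
    {p : Fin N → ℝ} {ψ : Fin N → X → ℂ} (h : IsPureDecomposition ρ p ψ) {x : X}
    (hx : ρ x x = 0) {i : Fin N} (hi : p i ≠ 0) : ψ i x = 0 := by
  have h1 : ∑ i, p i * ‖ψ i x‖ ^ 2 = 0 := by
    have h2 := h.decomp
    rw [h2, Matrix.sum_apply] at hx
    apply Complex.ofReal_injective
    rw [Complex.ofReal_zero, ← hx, Complex.ofReal_sum]
    refine Finset.sum_congr rfl fun i _ => ?_
    simp [proj, Matrix.vecMulVec_apply, Complex.mul_conj']
  have h3 := (Finset.sum_eq_zero_iff_of_nonneg fun i _ =>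
    mul_nonneg (h.nonneg i) (sq_nonneg _)).1 h1 i (Finset.mem_univ i)
  simpa [hi] using h3

section Bipartite

variable {A B : Type*} [Fintype A] [DecidableEq A] [Fintype B] [DecidableEq B]

theorem IsPureDecomposition.mul_renyiEntanglement {α : ℝ} (hα : 0 < α) {a₀ : A} {b₀ : B}
    {ρ : Matrix (A × B) (A × B) ℂ} (hρ : ∀ x y, x ≠ a₀ → y ≠ b₀ → ρ (x, y) (x, y) = 0) {N : ℕ}
    {p : Fin N → ℝ} {ψ : Fin N → A × B → ℂ} (h : IsPureDecomposition ρ p ψ) (i : Fin N) :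
    p i * renyiEntanglement α (ψ i) = p i * productRenyi α (weightProd a₀ b₀ (ψ i)) := by
  by_cases hi : p i = 0
  · simp [hi]
  · rw [renyiEntanglement_eq hα (h.unit i)
      (fun x y hx hy => h.apply_eq_zero (hρ x y hx hy) hi)]

theorem IsPureDecomposition.mul_productRenyi_nonneg {α : ℝ} (hα : 0 < α) {a₀ : A} {b₀ : B}
    {ρ : Matrix (A × B) (A × B) ℂ} (hρ : ∀ x y, x ≠ a₀ → y ≠ b₀ → ρ (x, y) (x, y) = 0) {N : ℕ}
    {p : Fin N → ℝ} {ψ : Fin N → A × B → ℂ} (h : IsPureDecomposition ρ p ψ) (i : Fin N) :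
    0 ≤ p i * productRenyi α (weightProd a₀ b₀ (ψ i)) := by
  by_cases hi : p i = 0
  · simp [hi]
  · exact mul_nonneg (h.nonneg i) (productRenyi_nonneg hα (weightProd_nonneg _ _ _)
      (weightProd_le (h.unit i) fun x y hx hy => h.apply_eq_zero (hρ x y hx hy) hi))

theorem renyiAssistance_nonneg {α : ℝ} (hα : 0 < α) {a₀ : A} {b₀ : B}
    {ρ : Matrix (A × B) (A × B) ℂ} (hρ : ∀ x y, x ≠ a₀ → y ≠ b₀ → ρ (x, y) (x, y) = 0) :
    0 ≤ renyiAssistance α ρ := by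
  refine Real.sSup_nonneg ?_
  rintro _ ⟨N, p, ψ, h, rfl⟩
  refine Finset.sum_nonneg fun i _ => ?_
  rw [h.mul_renyiEntanglement hα hρ]
  exact h.mul_productRenyi_nonneg hα hρ i

/-- Needed for lower bounds on the assistance: the real `sSup` of an unbounded set is `0`. -/
theorem bddAbove_renyiAssistance {α : ℝ} (hα : 0 < α) {a₀ : A} {b₀ : B}
    {ρ : Matrix (A × B) (A × B) ℂ} (hρ : ∀ x y, x ≠ a₀ → y ≠ b₀ → ρ (x, y) (x, y) = 0) :
    BddAbove {e : ℝ | ∃ (N : ℕ) (p : Fin N → ℝ) (ψ : Fin N → A × B → ℂ),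
      IsPureDecomposition ρ p ψ ∧ e = ∑ i, p i * renyiEntanglement α (ψ i)} := by
  obtain ⟨C, hC⟩ := exists_productRenyi_le hα
  refine ⟨C, ?_⟩
  rintro _ ⟨N, p, ψ, h, rfl⟩
  calc ∑ i, p i * renyiEntanglement α (ψ i) ≤ ∑ i, p i * C := by
        refine Finset.sum_le_sum fun i _ => ?_
        rw [h.mul_renyiEntanglement hα hρ]
        by_cases hi : p i = 0
        · simp [hi]
        · exact mul_le_mul_of_nonneg_left (hC _ (weightProd_nonneg _ _ _)
            (weightProd_le (h.unit i) fun x y hx hy => h.apply_eq_zero (hρ x y hx hy) hi))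
            (h.nonneg i)
    _ = C := by rw [← Finset.sum_mul, h.sum_eq_one, one_mul]

theorem sum_le_renyiAssistance {α : ℝ} (hα : 0 < α) {a₀ : A} {b₀ : B}
    {ρ : Matrix (A × B) (A × B) ℂ} (hρ : ∀ x y, x ≠ a₀ → y ≠ b₀ → ρ (x, y) (x, y) = 0)
    {ι : Type*} [Fintype ι] (p : ι → ℝ) (ψ : ι → A × B → ℂ) (hp : ∀ i, 0 ≤ p i)
    (hp1 : ∑ i, p i = 1) (hψ : ∀ i, IsUnitVec (ψ i)) (hd : ρ = ∑ i, (p i : ℂ) • proj (ψ i)) :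
    ∑ i, p i * renyiEntanglement α (ψ i) ≤ renyiAssistance α ρ := by
  let e := (Fintype.equivFin ι).symm
  refine le_csSup (bddAbove_renyiAssistance hα hρ)
    ⟨Fintype.card ι, p ∘ e, ψ ∘ e, ⟨fun i => hp _, ?_, fun i => hψ _, ?_⟩, ?_⟩
  · rw [← hp1]; exact e.sum_comp p
  · rw [hd]; exact (e.sum_comp fun i => (p i : ℂ) • proj (ψ i)).symm
  · exact (e.sum_comp fun i => p i * renyiEntanglement α (ψ i)).symm

theorem isUnitVec_single {X : Type*} [Fintype X] [DecidableEq X] (o : X) :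
    IsUnitVec (Pi.single o 1 : X → ℂ) := by
  rw [IsUnitVec, Fintype.sum_eq_single o fun x hx => by simp [hx]]
  simp

theorem weightProd_congr {a₀ : A} {b₀ : B} {φ χ : A × B → ℂ}
    (h : ∀ w, w ≠ (a₀, b₀) → φ w = χ w) : weightProd a₀ b₀ φ = weightProd a₀ b₀ χ := by
  rw [weightProd, weightProd]
  congr 1
  · refine Finset.sum_congr rfl fun x hx => ?_
    rw [h _ fun e => Finset.ne_of_mem_erase hx (congrArg Prod.fst e)]
  · refine Finset.sum_congr rfl fun y hy => ?_
    rw [h _ fun e => Finset.ne_of_mem_erase hy (congrArg Prod.snd e)]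

/-- A pure state of a tripartite system with at most one excited party: discarding the third party
leaves a state with an ensemble whose members have the same entanglement. -/
theorem exists_marginal_ensemble {C : Type*} [Fintype C] [DecidableEq C] {α : ℝ} (hα : 0 < α)
    {a₀ : A} {b₀ : B} {c₀ : C} {φ : (A × B) × C → ℂ} (hu : IsUnitVec φ)
    (h1 : ∀ w z, w ≠ (a₀, b₀) → z ≠ c₀ → φ (w, z) = 0)
    (h2 : ∀ x y z, x ≠ a₀ → y ≠ b₀ → φ ((x, y), z) = 0) :
    ∃ χ : Fin 2 → A × B → ℂ, (∀ s, IsUnitVec (χ s)) ∧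
      ∑ s, (1 / 2 : ℂ) • proj (χ s) = traceRight (proj φ) ∧
      ∀ s, renyiEntanglement α (χ s) =
        productRenyi α (weightProd a₀ b₀ fun w => φ (w, c₀)) := by
  have hsum := sum_prod_of_support (fun w => ‖φ w‖ ^ 2) (a₀ := (a₀, b₀)) (b₀ := c₀)
    (fun x y hx hy => by simp [h1 x y hx hy])
  rw [IsUnitVec] at hu
  rw [hu] at hsum
  obtain ⟨χ, hχ, hne, hd⟩ := exists_vacuum_ensemble (a₀, b₀) (fun w => φ (w, c₀))
    (w := ∑ z ∈ Finset.univ.erase c₀, ‖φ ((a₀, b₀), z)‖ ^ 2)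
    (Finset.sum_nonneg fun _ _ => by positivity) hsum.symm
  refine ⟨χ, hχ, ?_, fun s => ?_⟩
  · rw [hd, traceRight_proj h1]
  · rw [renyiEntanglement_eq hα (hχ s) (a₀ := a₀) (b₀ := b₀), weightProd_congr (hne s)]
    intro x y hx hy
    rw [hne s _ fun e => hx (congrArg Prod.fst e), h2 x y c₀ hx hy]

/-- A decomposition of a state with at most one excited party bounds the entanglement of assistance
of its marginals from below. -/
theorem sum_le_renyiAssistance_marginal {C Y : Type*} [Fintype C] [DecidableEq C] [Fintype Y]
    {α : ℝ} (hα : 0 < α) (f : (A × B) × C ≃ Y) {a₀ : A} {b₀ : B} {c₀ : C} {ρ : Matrix Y Y ℂ}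
    (h1 : ∀ w z, w ≠ (a₀, b₀) → z ≠ c₀ → ρ (f (w, z)) (f (w, z)) = 0)
    (h2 : ∀ x y z, x ≠ a₀ → y ≠ b₀ → ρ (f ((x, y), z)) (f ((x, y), z)) = 0)
    {N : ℕ} {p : Fin N → ℝ} {φ : Fin N → Y → ℂ} (h : IsPureDecomposition ρ p φ) :
    ∑ i, p i * productRenyi α (weightProd a₀ b₀ fun w => φ i (f (w, c₀)))
      ≤ renyiAssistance α (traceRight (ρ.submatrix f f)) := by
  have key : ∀ i, ∃ χ : Fin 2 → A × B → ℂ, (∀ s, IsUnitVec (χ s)) ∧ (p i ≠ 0 →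
      ∑ s, (1 / 2 : ℂ) • proj (χ s) = traceRight (proj (φ i ∘ f)) ∧
      ∀ s, renyiEntanglement α (χ s) =
        productRenyi α (weightProd a₀ b₀ fun w => φ i (f (w, c₀)))) := by
    intro i
    by_cases hi : p i = 0
    -- A member of weight zero has unconstrained support, so an arbitrary unit vector stands in for
    -- it.
    · exact ⟨fun _ => Pi.single (a₀, b₀) 1, fun _ => isUnitVec_single _, fun h => (h hi).elim⟩
    · obtain ⟨χ, hu, hd⟩ := exists_marginal_ensemble hα (a₀ := a₀) (b₀ := b₀) (c₀ := c₀)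
        (φ := φ i ∘ f)
        (by rw [IsUnitVec, ← h.unit i]; exact f.sum_comp fun y => ‖φ i y‖ ^ 2)
        (fun w z hw hz => h.apply_eq_zero (h1 w z hw hz) hi)
        (fun x y z hx hy => h.apply_eq_zero (h2 x y z hx hy) hi)
      exact ⟨χ, hu, fun _ => hd⟩
  choose χ hu hχ using key
  have hρ : ∀ x y, x ≠ a₀ → y ≠ b₀ → traceRight (ρ.submatrix f f) (x, y) (x, y) = 0 := by
    intro x y hx hy
    exact Finset.sum_eq_zero fun z _ => h2 x y z hx hy
  have hp : ∑ w : Fin N × Fin 2, p w.1 * (1 / 2) = 1 := by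
    rw [Fintype.sum_prod_type]
    refine (Finset.sum_congr rfl fun i _ => ?_).trans h.sum_eq_one
    rw [Fin.sum_univ_two]
    ring
  have hle := sum_le_renyiAssistance hα hρ (ι := Fin N × Fin 2) (fun w => p w.1 * (1 / 2))
    (fun w => χ w.1 w.2) (fun w => mul_nonneg (h.nonneg _) (by norm_num))
    hp (fun w => hu _ _) ?_
  · refine le_trans (le_of_eq ?_) hle
    rw [Fintype.sum_prod_type]
    refine Finset.sum_congr rfl fun i _ => ?_
    by_cases hi : p i = 0
    · simp [hi]
    · simp only [(hχ i hi).2, Fin.sum_univ_two]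
      ring
  · have hd : traceRight (ρ.submatrix f f) = ∑ i, (p i : ℂ) • traceRight (proj (φ i ∘ f)) := by
      ext w w'
      rw [h.decomp]
      simp only [traceRight, proj, Matrix.of_apply, Matrix.submatrix_apply, Matrix.sum_apply,
        Matrix.smul_apply, Matrix.vecMulVec_apply, Pi.star_apply, Function.comp_apply,
        Finset.smul_sum]
      exact Finset.sum_comm
    rw [hd, Fintype.sum_prod_type]
    refine Finset.sum_congr rfl fun i _ => ?_
    by_cases hi : p i = 0
    · simp [hi]
    · rw [← (hχ i hi).1, Finset.smul_sum]
      refine Finset.sum_congr rfl fun s _ => ?_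
      rw [smul_smul]
      push_cast
      rfl

/-- Polygamy of the entanglement of assistance, for a family of marginals over which the excitation
weight of every pure state distributes. -/
theorem renyiAssistance_le_sum {J : Type*} [Fintype J] {C B' : J → Type*}
    [∀ j, Fintype (C j)] [∀ j, DecidableEq (C j)] [∀ j, Fintype (B' j)] [∀ j, DecidableEq (B' j)]
    {α : ℝ} (hα : 0 < α) (hα' : α ^ 2 + α ≤ 3) {a₀ : A} {b₀ : B} (b : ∀ j, B' j) (c : ∀ j, C j)
    (f : ∀ j, (A × B' j) × C j ≃ A × B) {ρ : Matrix (A × B) (A × B) ℂ}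
    (h0 : ∀ x y, x ≠ a₀ → y ≠ b₀ → ρ (x, y) (x, y) = 0)
    (h1 : ∀ j w z, w ≠ (a₀, b j) → z ≠ c j → ρ (f j (w, z)) (f j (w, z)) = 0)
    (h2 : ∀ j x y z, x ≠ a₀ → y ≠ b j → ρ (f j ((x, y), z)) (f j ((x, y), z)) = 0)
    (hw : ∀ φ : A × B → ℂ, (∀ w, ρ w w = 0 → φ w = 0) →
      weightProd a₀ b₀ φ = ∑ j, weightProd a₀ (b j) fun w => φ (f j (w, c j))) :
    renyiAssistance α ρ ≤ ∑ j, renyiAssistance α (traceRight (ρ.submatrix (f j) (f j))) := by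
  -- `Real.sSup_le` asks for a nonnegative bound because `sSup ∅ = 0`.
  have hnn : 0 ≤ ∑ j, renyiAssistance α (traceRight (ρ.submatrix (f j) (f j))) :=
    Finset.sum_nonneg fun j _ => renyiAssistance_nonneg hα (a₀ := a₀) (b₀ := b j)
      fun x y hx hy => Finset.sum_eq_zero fun z _ => h2 j x y z hx hy
  refine Real.sSup_le ?_ hnn
  rintro _ ⟨N, p, φ, h, rfl⟩
  calc ∑ i, p i * renyiEntanglement α (φ i)
      ≤ ∑ i, ∑ j, p i * productRenyi α (weightProd a₀ (b j) fun w => φ i (f j (w, c j))) := by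
        refine Finset.sum_le_sum fun i _ => ?_
        rw [h.mul_renyiEntanglement hα h0]
        by_cases hi : p i = 0
        · simp [hi]
        · rw [← Finset.mul_sum]
          refine mul_le_mul_of_nonneg_left ?_ (h.nonneg i)
          have hle := weightProd_le (h.unit i) fun x y hx hy => h.apply_eq_zero (h0 x y hx hy) hi
          have hwi := hw (φ i) fun w hw => h.apply_eq_zero hw hi
          rw [hwi] at hle ⊢
          exact productRenyi_sum_le hα hα' _ _ (fun j _ => weightProd_nonneg _ _ _) hle
    _ = ∑ j, ∑ i, p i * productRenyi α (weightProd a₀ (b j) fun w => φ i (f j (w, c j))) :=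
        Finset.sum_comm
    _ ≤ _ := Finset.sum_le_sum fun j _ =>
        sum_le_renyiAssistance_marginal hα (f j) (h1 j) (h2 j) h

end Bipartite

/-! ### Marginals of generalized W-vacuum states -/

section Qudits

variable {n d : ℕ}

/-- Levels on a set of qudits are pairs of levels on the two parts of a partition of it. -/
def splitEquiv {S S' T : Finset (Fin n)} (hS : S ⊆ T) (hS' : S' ⊆ T) (hT : ∀ i ∈ T, i ∈ S ∨ i ∈ S')
    (hd : Disjoint S S') : (S → Fin d) × (S' → Fin d) ≃ (T → Fin d) where
  toFun w i := if h : i.1 ∈ S then w.1 ⟨i.1, h⟩ else w.2 ⟨i.1, (hT i.1 i.2).resolve_left h⟩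
  invFun f := (fun i => f ⟨i.1, hS i.2⟩, fun i => f ⟨i.1, hS' i.2⟩)
  left_inv w := by
    refine Prod.ext (funext fun i => ?_) (funext fun i => ?_)
    · simp
    · have h := Finset.disjoint_right.1 hd i.2
      simp [h]
  right_inv f := by
    funext i
    by_cases h : i.1 ∈ S <;> simp [h]

theorem extend_merge_left {P Q : Finset (Fin n)} (w : (P → Fin d) × (Q → Fin d))
    (z : ↥((P ∪ Q)ᶜ) → Fin d) (i : P) : extend (merge w) z i.1 = w.1 i := by
  have h : i.1 ∈ P ∪ Q := Finset.mem_union_left _ i.2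
  simp [extend, merge]

theorem extend_merge_right {P Q : Finset (Fin n)} (hPQ : Disjoint P Q)
    (w : (P → Fin d) × (Q → Fin d)) (z : ↥((P ∪ Q)ᶜ) → Fin d) (i : Q) :
    extend (merge w) z i.1 = w.2 i := by
  have h : i.1 ∈ P ∪ Q := Finset.mem_union_right _ i.2
  have h' : i.1 ∉ P := fun hp => Finset.disjoint_left.1 hPQ hp i.2
  simp [extend, merge, h']

/-- The bipartite configurations of `P` and `Q`, with `Q` split into a subset and the rest. -/
def cutEquiv (P : Finset (Fin n)) {R Q : Finset (Fin n)} (hR : R ⊆ Q) :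
    ((P → Fin d) × (R → Fin d)) × (↥(Q \ R) → Fin d) ≃ (P → Fin d) × (Q → Fin d) :=
  (Equiv.prodAssoc _ _ _).trans (Equiv.prodCongr (Equiv.refl _)
    (splitEquiv hR Finset.sdiff_subset
      (fun i hi => by by_cases h : i ∈ R <;> simp [h, hi]) Finset.disjoint_sdiff))

theorem cutEquiv_fst (P : Finset (Fin n)) {R Q : Finset (Fin n)} (hR : R ⊆ Q)
    (w : ((P → Fin d) × (R → Fin d)) × (↥(Q \ R) → Fin d)) : (cutEquiv P hR w).1 = w.1.1 := rfl

theorem cutEquiv_snd_of_mem (P : Finset (Fin n)) {R Q : Finset (Fin n)} (hR : R ⊆ Q)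
    (w : ((P → Fin d) × (R → Fin d)) × (↥(Q \ R) → Fin d)) (i : R) :
    (cutEquiv P hR w).2 ⟨i.1, hR i.2⟩ = w.1.2 i := by
  simp [cutEquiv, splitEquiv]

theorem cutEquiv_snd_of_mem_sdiff (P : Finset (Fin n)) {R Q : Finset (Fin n)} (hR : R ⊆ Q)
    (w : ((P → Fin d) × (R → Fin d)) × (↥(Q \ R) → Fin d)) (i : ↥(Q \ R)) :
    (cutEquiv P hR w).2 ⟨i.1, (Finset.mem_sdiff.1 i.2).1⟩ = w.2 i := by
  simp [cutEquiv, splitEquiv, (Finset.mem_sdiff.1 i.2).2]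

theorem extend_merge_cutEquiv {P R Q : Finset (Fin n)} (hR : R ⊆ Q) (hPQ : Disjoint P Q)
    (x : P → Fin d) (y : R → Fin d) (z : ↥(Q \ R) → Fin d) (Z : ↥((P ∪ Q)ᶜ) → Fin d)
    (h1 : Q \ R ⊆ (P ∪ R)ᶜ) (h2 : (P ∪ Q)ᶜ ⊆ (P ∪ R)ᶜ)
    (h3 : ∀ i ∈ (P ∪ R)ᶜ, i ∈ Q \ R ∨ i ∈ (P ∪ Q)ᶜ) (h4 : Disjoint (Q \ R) (P ∪ Q)ᶜ) :
    extend (merge (cutEquiv P hR ((x, y), z))) Z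
      = extend (merge (x, y)) (splitEquiv h1 h2 h3 h4 (z, Z)) := by
  have hPR : Disjoint P R := hPQ.mono_right hR
  funext i
  by_cases hP : i ∈ P
  · rw [extend_merge_left _ _ ⟨i, hP⟩, extend_merge_left _ _ ⟨i, hP⟩, cutEquiv_fst]
  by_cases hiR : i ∈ R
  · rw [extend_merge_right hPQ _ _ ⟨i, hR hiR⟩, extend_merge_right hPR _ _ ⟨i, hiR⟩]
    exact cutEquiv_snd_of_mem P hR _ ⟨i, hiR⟩
  by_cases hQ : i ∈ Q
  · rw [extend_merge_right hPQ _ _ ⟨i, hQ⟩]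
    refine (cutEquiv_snd_of_mem_sdiff P hR _ ⟨i, Finset.mem_sdiff.2 ⟨hQ, hiR⟩⟩).trans ?_
    simp [extend, splitEquiv, hP, hiR, hQ]
  · simp [extend, splitEquiv, hP, hiR, hQ]

/-- Tracing out a part of `Q` from the reduced state on `P` and `Q`. -/
theorem traceRight_reducedCut (ρ : Matrix (Fin n → Fin d) (Fin n → Fin d) ℂ)
    {P R Q : Finset (Fin n)} (hR : R ⊆ Q) (hPQ : Disjoint P Q) :
    traceRight ((reducedCut ρ P Q).submatrix (cutEquiv P hR) (cutEquiv P hR))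
      = reducedCut ρ P R := by
  have h1 : Q \ R ⊆ (P ∪ R)ᶜ := fun i hi => by
    have := Finset.mem_sdiff.1 hi
    have hP := Finset.disjoint_right.1 hPQ this.1
    simp [this.2, hP]
  have h2 : (P ∪ Q)ᶜ ⊆ (P ∪ R)ᶜ := Finset.compl_subset_compl.2 (Finset.union_subset_union_right hR)
  have h3 : ∀ i ∈ (P ∪ R)ᶜ, i ∈ Q \ R ∨ i ∈ (P ∪ Q)ᶜ := fun i hi => by
    simp only [Finset.mem_compl, Finset.mem_union, Finset.mem_sdiff] at *
    tauto
  have h4 : Disjoint (Q \ R) (P ∪ Q)ᶜ := Finset.disjoint_left.2 fun i hi hi' => by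
    simp only [Finset.mem_compl, Finset.mem_union, Finset.mem_sdiff] at *
    tauto
  ext ⟨x, y⟩ ⟨x', y'⟩
  simp only [traceRight, reducedCut, reduced, Matrix.of_apply, Matrix.submatrix_apply]
  rw [← (splitEquiv h1 h2 h3 h4).sum_comp, Fintype.sum_prod_type]
  refine Finset.sum_congr rfl fun z _ => Finset.sum_congr rfl fun Z _ => ?_
  rw [extend_merge_cutEquiv hR hPQ x y z Z h1 h2 h3 h4,
    extend_merge_cutEquiv hR hPQ x' y' z Z h1 h2 h3 h4]

variable [NeZero d]

theorem IsGWV.apply_eq_zero {ψ : (Fin n → Fin d) → ℂ} (hψ : IsGWV ψ) {f : Fin n → Fin d}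
    {i j : Fin n} (hij : i ≠ j) (hi : f i ≠ 0) (hj : f j ≠ 0) : ψ f = 0 := by
  obtain ⟨p, a, -, -, -, rfl⟩ := hψ
  have h0 : f ≠ 0 := fun h => hi (by rw [h]; rfl)
  have h1 : ∀ s l, f ≠ Pi.single s l := by
    rintro s l rfl
    have e1 : i = s := by by_contra h; exact hi (by simp [h])
    have e2 : j = s := by by_contra h; exact hj (by simp [h])
    exact hij (e1.trans e2.symm)
  simp [gwvVec, genW, ket, h0, h1, Finset.sum_apply]

theorem IsGWV.reducedCut_eq_zero {ψ : (Fin n → Fin d) → ℂ} (hψ : IsGWV ψ) {P Q : Finset (Fin n)}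
    (w : (P → Fin d) × (Q → Fin d))
    (h : ∀ z, ∃ i j, i ≠ j ∧ extend (merge w) z i ≠ 0 ∧ extend (merge w) z j ≠ 0) :
    reducedCut (proj ψ) P Q w w = 0 := by
  refine Finset.sum_eq_zero fun z _ => ?_
  obtain ⟨i, j, hij, hi, hj⟩ := h z
  simp [proj, Matrix.vecMulVec_apply, hψ.apply_eq_zero hij hi hj]

theorem IsGWV.reducedCut_eq_zero_of_ne {ψ : (Fin n → Fin d) → ℂ} (hψ : IsGWV ψ)
    {P Q : Finset (Fin n)} (hPQ : Disjoint P Q) (w : (P → Fin d) × (Q → Fin d)) (hx : w.1 ≠ 0)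
    (hy : w.2 ≠ 0) : reducedCut (proj ψ) P Q w w = 0 := by
  obtain ⟨i, hi⟩ := Function.ne_iff.1 hx
  obtain ⟨j, hj⟩ := Function.ne_iff.1 hy
  refine hψ.reducedCut_eq_zero _ fun z => ⟨i, j, fun h => ?_, ?_, ?_⟩
  · exact Finset.disjoint_left.1 hPQ i.2 (h ▸ j.2)
  · rwa [extend_merge_left]
  · rwa [extend_merge_right hPQ]

theorem IsGWV.reducedCut_eq_zero_of_right {ψ : (Fin n → Fin d) → ℂ} (hψ : IsGWV ψ)
    {P Q : Finset (Fin n)} (hPQ : Disjoint P Q) (w : (P → Fin d) × (Q → Fin d)) {i j : Q}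
    (hij : i ≠ j) (hi : w.2 i ≠ 0) (hj : w.2 j ≠ 0) : reducedCut (proj ψ) P Q w w = 0 := by
  refine hψ.reducedCut_eq_zero _ fun z => ⟨i, j, fun h => hij (Subtype.ext h), ?_, ?_⟩
  · rwa [extend_merge_right hPQ]
  · rwa [extend_merge_right hPQ]

/-- Padding by zeros identifies the left terms with configurations excited in `R` and nowhere else.
Those also excited in `Q \ R` have two excitations, so `F` kills them. -/
theorem sum_cutEquiv (P : Finset (Fin n)) {R Q : Finset (Fin n)} (hR : R ⊆ Q)
    (F : (Q → Fin d) → ℝ) (hF : ∀ y i j, i ≠ j → y i ≠ 0 → y j ≠ 0 → F y = 0) :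
    ∑ y ∈ Finset.univ.erase (0 : R → Fin d), F (cutEquiv P hR ((0, y), 0)).2
      = ∑ y : Q → Fin d, if ∃ i : Q, i.1 ∈ R ∧ y i ≠ 0 then F y else 0 := by
  classical
  let g : (R → Fin d) × (↥(Q \ R) → Fin d) ≃ (Q → Fin d) :=
    splitEquiv hR Finset.sdiff_subset
      (fun i hi => by by_cases h : i ∈ R <;> simp [h, hi]) Finset.disjoint_sdiff
  have hg : ∀ y z, (cutEquiv P hR ((0, y), z)).2 = g (y, z) := fun _ _ => rfl
  have hgR : ∀ y z (i : R), g (y, z) ⟨i.1, hR i.2⟩ = y i := fun y z i => by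
    rw [← hg, cutEquiv_snd_of_mem]
  have hgS : ∀ y z (i : ↥(Q \ R)), g (y, z) ⟨i.1, (Finset.mem_sdiff.1 i.2).1⟩ = z i :=
    fun y z i => by rw [← hg, cutEquiv_snd_of_mem_sdiff]
  rw [← g.sum_comp, Fintype.sum_prod_type]
  rw [← Finset.add_sum_erase Finset.univ _ (Finset.mem_univ (0 : R → Fin d))]
  have hz : ∀ z, ¬ ∃ i : Q, i.1 ∈ R ∧ g (0, z) i ≠ 0 := by
    rintro z ⟨i, hi, h⟩
    exact h (hgR 0 z ⟨i.1, hi⟩)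
  simp only [hz, if_false, Finset.sum_const_zero, zero_add]
  refine Finset.sum_congr rfl fun y hy => ?_
  obtain ⟨i, hi⟩ := Function.ne_iff.1 (Finset.ne_of_mem_erase hy)
  rw [Fintype.sum_eq_single 0, if_pos, hg]
  · exact ⟨⟨i.1, hR i.2⟩, i.2, by rw [hgR]; exact hi⟩
  · intro z hz
    obtain ⟨j, hj⟩ := Function.ne_iff.1 hz
    rw [hF (g (y, z)) ⟨i.1, hR i.2⟩ ⟨j.1, (Finset.mem_sdiff.1 j.2).1⟩ ?_ ?_ ?_, ite_self]
    · intro h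
      exact (Finset.mem_sdiff.1 j.2).2 ((congrArg Subtype.val h) ▸ i.2)
    · rw [hgR]; exact hi
    · rw [hgS]; exact hj

/-- A weight on singly excited levels of a union of disjoint sets is the sum of the weights on
the sets. -/
theorem sum_excited_biUnion {J : Type*} [Fintype J] {Q : J → Finset (Fin n)}
    (hQQ : ∀ i j, i ≠ j → Disjoint (Q i) (Q j)) (F : (↥(Finset.univ.biUnion Q) → Fin d) → ℝ)
    (hF : ∀ y i j, i ≠ j → y i ≠ 0 → y j ≠ 0 → F y = 0) :
    ∑ y ∈ Finset.univ.erase 0, F y = ∑ j, ∑ y : ↥(Finset.univ.biUnion Q) → Fin d,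
      if ∃ i : ↥(Finset.univ.biUnion Q), i.1 ∈ Q j ∧ y i ≠ 0 then F y else 0 := by
  classical
  rw [Finset.sum_comm, ← Finset.add_sum_erase Finset.univ _
    (Finset.mem_univ (0 : ↥(Finset.univ.biUnion Q) → Fin d))]
  simp only [Pi.zero_apply, ne_eq, not_true_eq_false, and_false, exists_false, if_false,
    Finset.sum_const_zero, zero_add]
  refine Finset.sum_congr rfl fun y hy => ?_
  obtain ⟨i, hi⟩ := Function.ne_iff.1 (Finset.ne_of_mem_erase hy)
  obtain ⟨j, -, hj⟩ := Finset.mem_biUnion.1 i.2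
  by_cases hFy : F y = 0
  · simp [hFy]
  rw [Fintype.sum_eq_single j, if_pos ⟨i, hj, hi⟩]
  intro j' hj'
  rw [if_neg]
  rintro ⟨i', hi', hy'⟩
  have : i = i' := by
    by_contra h
    exact hFy (hF y i i' h hi hy')
  subst this
  exact Finset.disjoint_left.1 (hQQ j' j hj') hi' hj

/-- Polygamy of the Rényi entanglement of assistance for generalized W-vacuum states. -/
theorem IsGWV.renyiAssistance_le_sum {ψ : (Fin n → Fin d) → ℂ} (hψ : IsGWV ψ) {J : Type*}
    [Fintype J] {P : Finset (Fin n)} {Q : J → Finset (Fin n)} (hPQ : ∀ j, Disjoint P (Q j))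
    (hQQ : ∀ i j, i ≠ j → Disjoint (Q i) (Q j)) {α : ℝ} (hα : 0 < α) (hα' : α ^ 2 + α ≤ 3) :
    renyiAssistance α (reducedCut (proj ψ) P (Finset.univ.biUnion Q))
      ≤ ∑ j, renyiAssistance α (reducedCut (proj ψ) P (Q j)) := by
  have hU : Disjoint P (Finset.univ.biUnion Q) :=
    (Finset.disjoint_biUnion_right _ _ _).2 fun j _ => hPQ j
  have hR : ∀ j, Q j ⊆ Finset.univ.biUnion Q :=
    fun j => Finset.subset_biUnion_of_mem Q (Finset.mem_univ j)
  have key := GWV.renyiAssistance_le_sum hα hα' (a₀ := 0) (b₀ := 0)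
    (ρ := reducedCut (proj ψ) P (Finset.univ.biUnion Q)) (B' := fun j => Q j → Fin d)
    (C := fun j => ↥(Finset.univ.biUnion Q \ Q j) → Fin d) (fun j => 0) (fun j => 0)
    (fun j => cutEquiv P (hR j)) (fun x y => hψ.reducedCut_eq_zero_of_ne hU (x, y)) ?_ ?_ ?_
  · simpa only [traceRight_reducedCut _ (hR _) hU] using key
  · rintro j ⟨x, y⟩ z hw hz
    obtain ⟨l, hl⟩ := Function.ne_iff.1 hz
    have hl' : _ = z l := cutEquiv_snd_of_mem_sdiff P (hR j) ((x, y), z) l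
    by_cases hx : x = 0
    · have hy : y ≠ 0 := fun h => hw (by rw [hx, h])
      obtain ⟨i, hi⟩ := Function.ne_iff.1 hy
      have hi' : _ = y i := cutEquiv_snd_of_mem P (hR j) ((x, y), z) i
      refine hψ.reducedCut_eq_zero_of_right hU _ ?_ (hi'.trans_ne hi) (hl'.trans_ne hl)
      intro h
      exact (Finset.mem_sdiff.1 l.2).2 ((congrArg Subtype.val h) ▸ i.2)
    · refine hψ.reducedCut_eq_zero_of_ne hU _ (by rwa [cutEquiv_fst]) fun h => hl ?_
      rw [← hl', h]; rfl
  · intro j x y z hx hy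
    obtain ⟨i, hi⟩ := Function.ne_iff.1 hy
    have hi' : _ = y i := cutEquiv_snd_of_mem P (hR j) ((x, y), z) i
    refine hψ.reducedCut_eq_zero_of_ne hU _ (by rwa [cutEquiv_fst]) fun h => hi ?_
    rw [← hi', h]; rfl
  · intro φ hφ
    have hF : ∀ (y : ↥(Finset.univ.biUnion Q) → Fin d) i j, i ≠ j → y i ≠ 0 → y j ≠ 0 →
        ‖φ (0, y)‖ ^ 2 = 0 := fun y i j hij hi hj => by
      simp [hφ (0, y) (hψ.reducedCut_eq_zero_of_right hU _ hij hi hj)]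
    -- With `Q` in the vacuum the embedding does not depend on `j`, so the weight on the side of `P`
    -- is a common factor.
    have h0 : ∀ j x, cutEquiv P (hR j) ((x, 0), (0 : ↥(Finset.univ.biUnion Q \ Q j) → Fin d))
        = (x, 0) := by
      intro j x
      refine Prod.ext rfl (funext fun i => ?_)
      by_cases h : i.1 ∈ Q j
      · exact cutEquiv_snd_of_mem P (hR j) ((x, 0), 0) ⟨i.1, h⟩
      · exact cutEquiv_snd_of_mem_sdiff P (hR j) ((x, 0), 0) ⟨i.1, Finset.mem_sdiff.2 ⟨i.2, h⟩⟩
    simp only [weightProd, h0]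
    rw [← Finset.mul_sum, sum_excited_biUnion hQQ (fun y => ‖φ (0, y)‖ ^ 2) hF]
    congr 1
    refine Finset.sum_congr rfl fun j _ => ?_
    exact (sum_cutEquiv P (hR j) (fun y => ‖φ (0, y)‖ ^ 2) hF).symm

end Qudits

/-! ### Weighted power inequality -/

/-- Both `x + 1` and `y` are convex combinations of `x` and `y + 1`, with exchanged weights; add the
two concavity inequalities. -/
theorem add_one_rpow_sub_rpow_antitone {μ x y : ℝ} (hμ0 : 0 ≤ μ) (hμ1 : μ ≤ 1) (hx : 0 ≤ x)
    (hxy : x ≤ y) : (y + 1) ^ μ - y ^ μ ≤ (x + 1) ^ μ - x ^ μ := by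
  have hc := Real.concaveOn_rpow hμ0 hμ1
  have hd : 0 < y + 1 - x := by linarith
  have hmx : x ∈ Set.Ici (0 : ℝ) := hx
  have hmy : y + 1 ∈ Set.Ici (0 : ℝ) := by simp only [Set.mem_Ici]; linarith
  have hp : 0 ≤ (y - x) / (y + 1 - x) := div_nonneg (by linarith) hd.le
  have hq : 0 ≤ 1 / (y + 1 - x) := by positivity
  have h1 := hc.2 hmx hmy hp hq (by field_simp; ring)
  have h2 := hc.2 hmx hmy hq hp (by field_simp; ring)
  simp only [smul_eq_mul] at h1 h2
  rw [show (y - x) / (y + 1 - x) * x + 1 / (y + 1 - x) * (y + 1) = x + 1 by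
    field_simp; ring] at h1
  rw [show 1 / (y + 1 - x) * x + (y - x) / (y + 1 - x) * (y + 1) = y by
    field_simp; ring] at h2
  have h3 : (y - x) / (y + 1 - x) = 1 - 1 / (y + 1 - x) := by field_simp; ring
  rw [h3] at h1 h2
  nlinarith

/-- Divide by `b ^ μ`: the unit increment of the power at `a / b ≥ 1 / k` is at most that at `1 /
k`, which is the stated constant. -/
theorem add_rpow_le {μ k a b : ℝ} (hμ0 : 0 < μ) (hμ1 : μ ≤ 1) (hk : 0 < k) (ha : 0 ≤ a)
    (hb : 0 ≤ b) (hab : b ≤ k * a) :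
    (a + b) ^ μ ≤ a ^ μ + ((1 + k) ^ μ - 1) / k ^ μ * b ^ μ := by
  rcases hb.eq_or_lt with rfl | hb
  · simp [Real.zero_rpow hμ0.ne']
  have h := add_one_rpow_sub_rpow_antitone hμ0.le hμ1 (x := 1 / k) (y := a / b) (by positivity)
    (by rw [div_le_div_iff₀ hk hb]; linarith)
  have e1 : a / b + 1 = (a + b) / b := by field_simp
  have e2 : 1 / k + 1 = (1 + k) / k := by field_simp
  rw [e1, e2, Real.div_rpow (by positivity) hb.le, Real.div_rpow (by positivity) hb.le,
    Real.div_rpow (by positivity) hk.le, Real.div_rpow (by positivity) hk.le, Real.one_rpow,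
    ← sub_div, ← sub_div, div_le_iff₀ (Real.rpow_pos_of_pos hb μ)] at h
  linarith

/-! ### Hamming weights and the pairing induction -/

theorem hammingWeight_two_mul (j : ℕ) : hammingWeight (2 * j) = hammingWeight j := by
  rcases Nat.eq_zero_or_pos j with rfl | hj
  · rfl
  · rw [hammingWeight, Nat.digits_def' one_lt_two (by omega), Nat.mul_mod_right,
      Nat.mul_div_cancel_left j two_pos]
    simp [hammingWeight]

theorem hammingWeight_two_mul_add_one (j : ℕ) :
    hammingWeight (2 * j + 1) = hammingWeight j + 1 := by
  rw [hammingWeight, Nat.digits_def' one_lt_two (by omega), show (2 * j + 1) % 2 = 1 by omega,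
    show (2 * j + 1) / 2 = j by omega]
  simp [hammingWeight]

theorem sum_range_two_mul {M : Type*} [AddCommMonoid M] (f : ℕ → M) (m : ℕ) :
    ∑ j ∈ Finset.range (2 * m), f j = ∑ j ∈ Finset.range m, (f (2 * j) + f (2 * j + 1)) := by
  induction m with
  | zero => simp
  | succ m ih => rw [mul_add, mul_one, Finset.sum_range_succ, Finset.sum_range_succ, ih,
      Finset.sum_range_succ, add_assoc]

/-- Pair neighbours: the sums `x (2j) + x (2j + 1)` still decrease by the factor `k`, as `k ≤ 1`.
The induction hypothesis weights each pair by the Hamming weight of `j`, and splitting the pair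
costs one more factor exactly at the odd index. -/
theorem sum_rpow_le_sum_hammingWeight {μ k : ℝ} (hμ0 : 0 < μ) (hμ1 : μ ≤ 1) (hk : 0 < k)
    (hk1 : k ≤ 1) (m : ℕ) : ∀ x : ℕ → ℝ, (∀ j, 0 ≤ x j) → (∀ j, x (j + 1) ≤ k * x j) →
      (∑ j ∈ Finset.range (2 ^ m), x j) ^ μ
        ≤ ∑ j ∈ Finset.range (2 ^ m), (((1 + k) ^ μ - 1) / k ^ μ) ^ hammingWeight j * x j ^ μ := by
  have hK : 0 ≤ ((1 + k) ^ μ - 1) / k ^ μ :=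
    div_nonneg (sub_nonneg.2 (Real.one_le_rpow (by linarith) hμ0.le)) (Real.rpow_nonneg hk.le μ)
  induction m with
  | zero => intro x _ _; simp [hammingWeight]
  | succ m ih =>
    intro x hx hord
    rw [pow_succ, mul_comm, sum_range_two_mul, sum_range_two_mul]
    refine (ih (fun j => x (2 * j) + x (2 * j + 1)) (fun j => add_nonneg (hx _) (hx _))
      fun j => ?_).trans (Finset.sum_le_sum fun j _ => ?_)
    · have h1 := hord (2 * j)
      have h2 := hord (2 * j + 1)
      have h3 := hord (2 * j + 1 + 1)
      have h4 := mul_le_mul_of_nonneg_left (mul_le_of_le_one_left (hx (2 * j)) hk1) hk.le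
      have h5 := mul_le_mul_of_nonneg_left h1 hk.le
      have h6 := mul_le_mul_of_nonneg_left h2 hk.le
      have h7 := mul_le_mul_of_nonneg_left (mul_le_of_le_one_left (hx (2 * j + 1)) hk1) hk.le
      rw [show 2 * (j + 1) = 2 * j + 1 + 1 by ring]
      rw [mul_add]
      linarith
    · rw [hammingWeight_two_mul, hammingWeight_two_mul_add_one, pow_succ, mul_assoc, ← mul_add]
      exact mul_le_mul_of_nonneg_left (add_rpow_le hμ0 hμ1 hk (hx _) (hx _) (hord _))
        (pow_nonneg hK _)

theorem sum_fin_rpow_le_sum_hammingWeight {μ k : ℝ} (hμ0 : 0 < μ) (hμ1 : μ ≤ 1) (hk : 0 < k)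
    (hk1 : k ≤ 1) {r : ℕ} (x : Fin r → ℝ) (hx : ∀ j, 0 ≤ x j)
    (hord : ∀ i j : Fin r, j.val = i.val + 1 → x j ≤ k * x i) :
    (∑ j, x j) ^ μ ≤ ∑ j : Fin r, (((1 + k) ^ μ - 1) / k ^ μ) ^ hammingWeight j.val * x j ^ μ := by
  -- Padding by zeros up to length `2 ^ r ≥ r` preserves the ordering and, as `μ > 0`, adds nothing
  -- to either sum.
  let y : ℕ → ℝ := fun j => if h : j < r then x ⟨j, h⟩ else 0
  have hy0 : ∀ j, r ≤ j → y j = 0 := fun j hj => dif_neg (not_lt.2 hj)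
  have hyx : ∀ j : Fin r, y j = x j := fun j => dif_pos j.2
  have hy : ∀ j, 0 ≤ y j := fun j => by
    rcases lt_or_ge j r with h | h
    · rw [hyx ⟨j, h⟩]; exact hx _
    · rw [hy0 j h]
  have hyo : ∀ j, y (j + 1) ≤ k * y j := fun j => by
    rcases lt_or_ge (j + 1) r with h | h
    · rw [hyx ⟨j + 1, h⟩, hyx ⟨j, by omega⟩]
      exact hord _ _ rfl
    · rw [hy0 _ h]; exact mul_nonneg hk.le (hy j)
  have key := sum_rpow_le_sum_hammingWeight hμ0 hμ1 hk hk1 r y hy hyo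
  have hext : ∀ f : ℕ → ℝ, (∀ j, r ≤ j → f j = 0) →
      ∑ j ∈ Finset.range (2 ^ r), f j = ∑ j : Fin r, f j := by
    intro f hf
    rw [Fin.sum_univ_eq_sum_range f r]
    refine (Finset.sum_subset (Finset.range_subset_range.2 Nat.lt_two_pow_self.le)
      fun j _ hj => hf j ?_).symm
    simpa using hj
  rw [hext y hy0, hext _ fun j hj => by rw [hy0 j hj, Real.zero_rpow hμ0.ne', mul_zero]] at key
  simpa only [hyx] using key

end GWV

theorem theorem11 {n d : ℕ} [NeZero d] (ψ : (Fin n → Fin d) → ℂ) (hψ : GWV.IsGWV ψ)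
    {r : ℕ} (P : Finset (Fin n)) (Q : Fin r → Finset (Fin n))
    (hP : P.Nonempty) (hQ : ∀ j, (Q j).Nonempty)
    (hPQ : ∀ j, Disjoint P (Q j)) (hQQ : ∀ i j, i ≠ j → Disjoint (Q i) (Q j))
    (α μ k : ℝ) (hα₁ : (√7 - 1) / 2 ≤ α) (hα₂ : α ≤ (√13 - 1) / 2)
    (hμ₀ : 0 < μ) (hμ₁ : μ ≤ 1) (hk₀ : 0 < k) (hk₁ : k ≤ 1)
    (hord : ∀ i j : Fin r, j.val = i.val + 1 →
      k * GWV.renyiAssistance α (GWV.reducedCut (GWV.proj ψ) P (Q i)) ≥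
        GWV.renyiAssistance α (GWV.reducedCut (GWV.proj ψ) P (Q j))) :
    GWV.renyiAssistance α (GWV.reducedCut (GWV.proj ψ) P (Finset.univ.biUnion Q)) ^ μ ≤
      ∑ j : Fin r, (((1 + k) ^ μ - 1) / k ^ μ) ^ GWV.hammingWeight j.val *
        GWV.renyiAssistance α (GWV.reducedCut (GWV.proj ψ) P (Q j)) ^ μ := by
  -- The lower end of the range gives `0 < α`; the upper end is the positive root of `α ^ 2 + α =
  -- 3`.
  have h7 : 1 < √7 := by rw [Real.lt_sqrt (by norm_num)]; norm_num
  have hα : 0 < α := by linarith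
  have hα' : α ^ 2 + α ≤ 3 := by
    nlinarith [Real.sq_sqrt (show (0 : ℝ) ≤ 13 by norm_num), Real.sqrt_nonneg 13]
  have hU : Disjoint P (Finset.univ.biUnion Q) :=
    (Finset.disjoint_biUnion_right _ _ _).2 fun j _ => hPQ j
  exact (Real.rpow_le_rpow
    (GWV.renyiAssistance_nonneg hα fun x y => hψ.reducedCut_eq_zero_of_ne hU (x, y))
    (hψ.renyiAssistance_le_sum hPQ hQQ hα hα') hμ₀.le).trans
    (GWV.sum_fin_rpow_le_sum_hammingWeight hμ₀ hμ₁ hk₀ hk₁ _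
      (fun j => GWV.renyiAssistance_nonneg hα fun x y =>
        hψ.reducedCut_eq_zero_of_ne (hPQ j) (x, y)) hord)
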